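/- For a Lebesgue measurable set $A\subseteq\mathbb R^d$ let \[\delta^*(A)=\lim_{N\to\infty}\ \sup_{t\in\mathbb R^d}\frac{|A\cap(t+Q_N)|}{|Q_N|},\qquad Q_N=[-N/2,N/2]^d,\] denote its upper Banach density, where $|\cdot|$ is Lebesgue measure. For $\lambda>0$ and a finite set $S\subseteq\mathbb R^k$ with $k\le d$, an isometric copy of $\lambda\cdot S$ in $\mathbb R^d$ is a set of the form $z+\lambda\cdot U(S)$ with $z\in\mathbb R^d$ and $U\in SO(d)$, where $\mathbb R^k$ is identified with the subspace of $\mathbb R^d$ spanned by the first $k$ coordinate vectors. Let $\Box=\{0,v_1,v_2,v_1+v_2\}\subseteq\mathbb R^2$, where $v_1,v_2$ are nonzero and $v_1\cdot v_2=0$, be a fixed two-dimensional rectangle, let $d\ge 4$, and let $A\subseteq\mathbb R^d$ be a Lebesgue measurable set with $\delta^*(A)>0$. Then there is a threshold $\lambda_0=\lambda_0(A,\Box)>0$ such that for every $\lambda\ge\lambda_0$ the set $A$ contains an isometric copy of $\lambda\cdot\Box$. Moreover, for every $\lambda\ge\lambda_0$ and every splitting of coordinates $\mathbb R^d=\mathbb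 R^{d_1}\times\mathbb R^{d_2}$ with $d_1+d_2=d$ and $d_1,d_2\ge 2$, the set $A$ contains such an isometric copy of $\lambda\cdot\Box$ of the special form \[\{(x,y),(x',y),(x,y'),(x',y')\}\subseteq\mathbb R^{d_1}\times\mathbb R^{d_2},\qquad |x-x'|=\lambda|v_1|,\quad |y-y'|=\lambda|v_2|.\] -/

import Mathlib

open MeasureTheory Filter
open scoped ENNReal

noncomputable section

namespace RectBanach

/-- The closed axis-parallel cube `t + [-N/2, N/2]^d` in `ℝ^d`. -/
def cube {d : ℕ} (t : EuclideanSpace ℝ (Fin d)) (N : ℝ) : Set (EuclideanSpace ℝ (Fin d)) :=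
  {x | ∀ i, x i ∈ Set.Icc (t i - N / 2) (t i + N / 2)}

/-- The upper Banach density
`δ*(A) = lim_{N → ∞} sup_t |A ∩ (t + Q_N)| / |Q_N|`, with `Q_N = [-N/2, N/2]^d`.
It is written with `limsup` (over real `N`, in `[0, ∞]`), which is the limit whenever the
limit exists. -/
def upperBanachDensity {d : ℕ} (A : Set (EuclideanSpace ℝ (Fin d))) : ℝ≥0∞ :=
  limsup (fun N : ℝ => ⨆ t : EuclideanSpace ℝ (Fin d),
    volume (A ∩ cube t N) / volume (cube (0 : EuclideanSpace ℝ (Fin d)) N)) atTop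

/-- The four vertices `{0, v₁, v₂, v₁ + v₂}`. -/
def rectangle (v₁ v₂ : EuclideanSpace ℝ (Fin 2)) : Set (EuclideanSpace ℝ (Fin 2)) :=
  {0, v₁, v₂, v₁ + v₂}

/-- The standard inclusion `ℝ^k ⊆ ℝ^d` as the first `k` coordinates (used for `k ≤ d`). -/
def incl (k d : ℕ) (p : EuclideanSpace ℝ (Fin k)) : EuclideanSpace ℝ (Fin d) :=
  WithLp.toLp 2 fun i => if h : (i : ℕ) < k then p ⟨i, h⟩ else 0

/-- `S'` is an isometric copy of `lam · S` in `ℝ^d`: `S' = x + lam · U(S)` for some `x ∈ ℝ^d` and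
some rotation `U ∈ SO(d)`, where `S ⊆ ℝ^k` is regarded as a subset of `ℝ^d`. -/
def IsIsometricCopy {k d : ℕ} (lam : ℝ) (S : Set (EuclideanSpace ℝ (Fin k)))
    (S' : Set (EuclideanSpace ℝ (Fin d))) : Prop :=
  ∃ (x : EuclideanSpace ℝ (Fin d))
    (U : EuclideanSpace ℝ (Fin d) ≃ₗᵢ[ℝ] EuclideanSpace ℝ (Fin d)),
    LinearMap.det (U.toLinearEquiv : EuclideanSpace ℝ (Fin d) →ₗ[ℝ] EuclideanSpace ℝ (Fin d)) = 1 ∧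
    S' = (fun p => x + lam • U (incl k d p)) '' S

/-- The point `(x, y)` of `ℝ^{d₁} × ℝ^{d₂} = ℝ^d`, where `d₁ + d₂ = d`. -/
def pair {d₁ d₂ d : ℕ} (h : d₁ + d₂ = d) (x : EuclideanSpace ℝ (Fin d₁))
    (y : EuclideanSpace ℝ (Fin d₂)) : EuclideanSpace ℝ (Fin d) :=
  WithLp.toLp 2 fun i => Fin.append (fun j => x j) (fun j => y j) (Fin.cast h.symm i)

end RectBanach

end

/-! Fix a plane in each factor of the splitting and let `corr f u w` count parallelograms with sides
`u`, `w` in a bounded piece of `A` with indicator `f`. If `w` is frozen, this count is the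
autocorrelation in `u` of `f · f(· + w)`, hence by Plancherel the cosine transform of a positive
finite measure; by symmetry the same holds in the other variable. Everything rests on this
positivity in each variable separately (`isBispectral_corr`).

Positivity lets inequalities between multipliers pass to averages of the count. Averaging over
circles has multiplier a Bessel function, averaging over Gaussian differences has multiplier `exp
(-r²)`. The Gaussian averages therefore decrease with the scale, and the circular average differs
from the Gaussian one by at most `ε` times the total mass plus `K` times the drop of the Gaussian
average between scales `s/2` and `s` (`exists_form_circ_ge`).

Suppose arbitrarily large dilates are missing. Choose many lacunary missing scales, and only then a
much larger cube in which `A` is dense. By monotonicity the total drop is bounded, so at one of the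
scales it is negligible (`exists_small_drop`). There the circular average is zero, yet it is close
to the Gaussian average, which the box-norm inequality bounds below in terms of the density alone
(`pow_four_le_form_heat`). This is a contradiction. Orthogonality of the two factors makes the
parallelograms rectangles, and a rotation identifies them with copies of the given one. -/

noncomputable section

namespace RectBanach

/-! ### Autocorrelations as cosine transforms of positive measures -/

section Plancherel

open FourierTransform SchwartzMap
open scoped ComplexInnerProductSpace

variable {V : Type*} [NormedAddCommGroup V] [InnerProductSpace ℝ V]

/-- The phase `ξ ↦ exp (2πi ⟨u, ξ⟩)`. -/
def phase (u ξ : V) : ℂ := Complex.exp ((2 * Real.pi * inner ℝ u ξ : ℝ) * Complex.I)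

lemma continuous_phase (u : V) : Continuous (phase u) := by
  unfold phase; fun_prop

lemma norm_phase (u ξ : V) : ‖phase u ξ‖ = 1 := Complex.norm_exp_ofReal_mul_I _

variable [FiniteDimensional ℝ V] [MeasurableSpace V] [BorelSpace V]

lemma memLp_phase (u : V) : MemLp (phase u) ∞ (volume : Measure V) :=
  memLp_top_of_bound (continuous_phase u).aestronglyMeasurable 1
    (Eventually.of_forall fun ξ => (norm_phase u ξ).le)

lemma fourier_translate_schwartz (φ : 𝓢(V, ℂ)) (u ξ : V) :
    𝓕 (φ.compSubConstCLM ℂ (-u)) ξ = phase u ξ * 𝓕 φ ξ := by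
  have h := congrFun (VectorFourier.fourierIntegral_comp_add_right Real.fourierChar
    (volume : Measure V) (innerₗ V) (φ : V → ℂ) u) ξ
  have h1 : ((φ.compSubConstCLM ℂ (-u) : 𝓢(V, ℂ)) : V → ℂ) = (φ : V → ℂ) ∘ fun v => v + u := by
    ext v; simp
  rw [SchwartzMap.fourier_coe, SchwartzMap.fourier_coe, h1]
  refine h.trans ?_
  rw [Circle.smul_def, Real.fourierChar_apply, smul_eq_mul]
  rfl

/-- Both sides are continuous in `φ` for the `L²` norm, so it is enough to verify the identity on
the dense class of Schwartz functions, where it is a change of variables. -/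
lemma fourier_translate (φ : Lp (α := V) ℂ 2) (u : V) :
    𝓕 (Lp.compMeasurePreserving (· + u) (measurePreserving_add_right volume u) φ) =
      ((memLp_phase u).toLp (phase u) • 𝓕 φ : Lp (α := V) ℂ 2) := by
  refine DenseRange.induction_on (p := fun φ : Lp (α := V) ℂ 2 =>
      𝓕 (Lp.compMeasurePreserving (· + u) (measurePreserving_add_right volume u) φ) =
      ((memLp_phase u).toLp (phase u) • 𝓕 φ : Lp (α := V) ℂ 2))
    (SchwartzMap.denseRange_toLpCLM (p := 2) ENNReal.ofNat_ne_top) φ ?_ ?_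
  · apply isClosed_eq
    · exact (Lp.fourierTransformₗᵢ V ℂ).continuous.comp
        (Lp.isometry_compMeasurePreserving _).continuous
    · exact (((ContinuousLinearMap.lsmul ℂ ℂ).holderL volume ∞ 2 2
        ((memLp_phase u).toLp (phase u)))).continuous.comp (Lp.fourierTransformₗᵢ V ℂ).continuous
  · intro ψ
    have h1 : Lp.compMeasurePreserving (· + u) (measurePreserving_add_right volume u)
        (ψ.toLp 2 (volume : Measure V)) = (ψ.compSubConstCLM ℂ (-u)).toLp 2 := by
      ext1
      refine (Lp.coeFn_compMeasurePreserving _ _).trans ?_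
      have h2 := (measurePreserving_add_right (volume : Measure V) u).quasiMeasurePreserving.ae
        (ψ.coeFn_toLp 2 (volume : Measure V))
      filter_upwards [h2, (ψ.compSubConstCLM ℂ (-u)).coeFn_toLp 2 (volume : Measure V)]
        with x hx hx2
      rw [hx2, Function.comp_apply, hx]; simp
    change 𝓕 (Lp.compMeasurePreserving (· + u) (measurePreserving_add_right volume u)
        (ψ.toLp 2 (volume : Measure V))) = _ • 𝓕 (ψ.toLp 2 (volume : Measure V))
    rw [h1, SchwartzMap.toLp_fourier_eq, SchwartzMap.toLp_fourier_eq]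
    ext1
    filter_upwards [(𝓕 (ψ.compSubConstCLM ℂ (-u))).coeFn_toLp 2 (volume : Measure V),
      (𝓕 ψ).coeFn_toLp 2 (volume : Measure V), (memLp_phase (V := V) u).coeFn_toLp,
      Lp.coeFn_lpSMul (r := 2) ((memLp_phase u).toLp (phase u))
        ((𝓕 ψ).toLp 2 (volume : Measure V))] with x a1 a2 a3 a4
    rw [a4, Pi.smul_apply', a1, a2, a3, fourier_translate_schwartz, smul_eq_mul]

/-- The autocorrelation of a square integrable function is the cosine transform of a finite
measure. -/
theorem exists_spectral_measure {g : V → ℝ} (hg : MemLp g 2 (volume : Measure V)) :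
    ∃ m : Measure V, IsFiniteMeasure m ∧
      ∀ u, ∫ v, g v * g (v + u) = ∫ ξ, Real.cos (inner ℝ u ξ) ∂m := by
  have hgc : MemLp (fun v => (g v : ℂ)) 2 (volume : Measure V) := hg.ofReal
  set φ : Lp (α := V) ℂ 2 volume := hgc.toLp _ with hφ
  set ψ : Lp (α := V) ℂ 2 volume := 𝓕 φ with hψ
  have hint : Integrable (fun ξ => ‖ψ ξ‖ ^ 2) (volume : Measure V) :=
    (memLp_two_iff_integrable_sq_norm (Lp.aestronglyMeasurable ψ)).1 (Lp.memLp ψ)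
  set m₀ : Measure V := volume.withDensity fun ξ => ENNReal.ofReal (‖ψ ξ‖ ^ 2) with hm₀
  have hfin : IsFiniteMeasure m₀ := isFiniteMeasure_withDensity_ofReal hint.2
  have hmeas : Measurable fun ξ : V => (2 * Real.pi) • ξ := by fun_prop
  -- The dilation absorbs the factor `2π` in the normalisation of the Fourier transform.
  refine ⟨m₀.map fun ξ => (2 * Real.pi) • ξ, inferInstance, fun u => ?_⟩
  have h1 : inner ℂ φ (Lp.compMeasurePreserving (· + u) (measurePreserving_add_right volume u) φ)
      = ((∫ v, g v * g (v + u) : ℝ) : ℂ) := by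
    rw [L2.inner_def, ← integral_complex_ofReal]
    refine integral_congr_ae ?_
    have h2 := (measurePreserving_add_right (volume : Measure V) u).quasiMeasurePreserving.ae
      hgc.coeFn_toLp
    filter_upwards [hgc.coeFn_toLp, h2, Lp.coeFn_compMeasurePreserving φ
      (measurePreserving_add_right (volume : Measure V) u)] with x a1 a2 a3
    rw [a3, Function.comp_apply, hφ, a1, a2]
    simp [mul_comm]
  have h2 : inner ℂ φ (Lp.compMeasurePreserving (· + u) (measurePreserving_add_right volume u) φ)
      = ∫ ξ, phase u ξ * ((‖ψ ξ‖ ^ 2 : ℝ) : ℂ) := by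
    rw [← Lp.inner_fourier_eq, fourier_translate, L2.inner_def]
    refine integral_congr_ae ?_
    filter_upwards [(memLp_phase u).coeFn_toLp,
      Lp.coeFn_lpSMul (r := 2) ((memLp_phase u).toLp (phase u)) ψ] with x a1 a2
    rw [a2, Pi.smul_apply', a1, ← hψ, smul_eq_mul, RCLike.inner_apply, mul_assoc,
      Complex.mul_conj, Complex.normSq_eq_norm_sq]
  have h3 : ∫ v, g v * g (v + u) = ∫ ξ, Real.cos (2 * Real.pi * inner ℝ u ξ) * ‖ψ ξ‖ ^ 2 := by
    -- The autocorrelation is real, so only the cosine part of the phase contributes.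
    have h4 : (∫ v, g v * g (v + u)) = (∫ ξ, phase u ξ * ((‖ψ ξ‖ ^ 2 : ℝ) : ℂ)).re := by
      rw [← h2, h1, Complex.ofReal_re]
    rw [h4]
    have hi : Integrable (fun ξ => phase u ξ * ((‖ψ ξ‖ ^ 2 : ℝ) : ℂ)) (volume : Measure V) := by
      refine hint.ofReal.bdd_mul (c := 1) (continuous_phase u).aestronglyMeasurable
        (Eventually.of_forall fun ξ => (norm_phase u ξ).le)
    have := integral_re hi
    simp only [RCLike.re_eq_complex_re] at this
    rw [← this]
    refine integral_congr_ae (Eventually.of_forall fun ξ => ?_)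
    simp only [Complex.re_mul_ofReal, phase, Complex.exp_ofReal_mul_I_re]
  rw [h3, integral_map hmeas.aemeasurable (by fun_prop), hm₀,
    integral_withDensity_eq_integral_toReal_smul₀]
  · refine integral_congr_ae (Eventually.of_forall fun ξ => ?_)
    simp only [inner_smul_right, smul_eq_mul]
    rw [ENNReal.toReal_ofReal (by positivity), mul_comm]
  · exact hint.1.aemeasurable.ennreal_ofReal
  · exact Eventually.of_forall fun ξ => ENNReal.ofReal_lt_top

end Plancherel

/-! ### Circular and Gaussian averages, and comparison of their multipliers -/

section CircleAndHeat

open ProbabilityTheory Topology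

/-- The normalised cosine transform of a circle, as a function of the frequency. -/
def circleTransform (r : ℝ) : ℝ := Real.pi⁻¹ * ∫ t in (0 : ℝ)..Real.pi, Real.cos (r * Real.cos t)

lemma continuous_circleTransform : Continuous circleTransform := by
  unfold circleTransform
  refine continuous_const.mul ?_
  exact intervalIntegral.continuous_parametric_intervalIntegral_of_continuous' (by fun_prop) _ _

lemma circleTransform_zero : circleTransform 0 = 1 := by
  simp [circleTransform, Real.pi_ne_zero]

lemma abs_circleTransform_le (r : ℝ) : |circleTransform r| ≤ 1 := by
  have h := intervalIntegral.norm_integral_le_of_norm_le_const (a := 0) (b := Real.pi) (C := 1)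
    (f := fun t => Real.cos (r * Real.cos t)) (fun t _ => by
      simpa using Real.abs_cos_le_one _)
  rw [circleTransform, abs_mul, abs_of_pos (inv_pos.2 Real.pi_pos)]
  rw [Real.norm_eq_abs, one_mul, sub_zero, abs_of_pos Real.pi_pos] at h
  calc _ ≤ Real.pi⁻¹ * Real.pi := by gcongr
    _ = 1 := inv_mul_cancel₀ Real.pi_ne_zero

/-- The substitution `u = cos t` exhibits the circle transform as the Fourier transform of the
arcsine density, which puts it in the scope of the Riemann–Lebesgue lemma. -/
lemma integral_comp_cos (w : ℝ) :
    ∫ u, Real.fourierChar (-(u * w)) •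
      (Real.cos '' Set.Ioo 0 Real.pi).indicator (fun u => ((√(1 - u ^ 2))⁻¹ : ℂ)) u =
    ∫ t in Set.Ioo 0 Real.pi, (Real.fourierChar (-(Real.cos t * w)) : ℂ) := by
  have hinj : Set.InjOn Real.cos (Set.Ioo 0 Real.pi) :=
    Real.injOn_cos.mono Set.Ioo_subset_Icc_self
  have hS : MeasurableSet (Real.cos '' Set.Ioo 0 Real.pi) :=
    measurableSet_Ioo.image_of_measurable_injOn Real.continuous_cos.measurable hinj
  have h1 : ∀ u, Real.fourierChar (-(u * w)) •
      (Real.cos '' Set.Ioo 0 Real.pi).indicator (fun u => ((√(1 - u ^ 2))⁻¹ : ℂ)) u =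
      (Real.cos '' Set.Ioo 0 Real.pi).indicator
        (fun u => (Real.fourierChar (-(u * w)) : ℂ) * ((√(1 - u ^ 2))⁻¹ : ℂ)) u := by
    intro u
    by_cases hu : u ∈ Real.cos '' Set.Ioo 0 Real.pi
    · simp only [Set.indicator_of_mem hu, Circle.smul_def, smul_eq_mul]
    · simp only [Set.indicator_of_notMem hu, smul_zero]
  simp_rw [h1]
  rw [integral_indicator hS, integral_image_eq_integral_abs_deriv_smul measurableSet_Ioo
    (fun x _ => (Real.hasDerivAt_cos x).hasDerivWithinAt) hinj]
  refine setIntegral_congr_fun measurableSet_Ioo fun t ht => ?_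
  have hs : 0 < Real.sin t := Real.sin_pos_of_mem_Ioo ht
  have hs' : √(1 - Real.cos t ^ 2) = Real.sin t := by
    rw [← Real.sin_sq, Real.sqrt_sq hs.le]
  simp only [abs_neg, abs_of_pos hs, hs', Complex.real_smul]
  have : (Real.sin t : ℂ) ≠ 0 := by exact_mod_cast hs.ne'
  field_simp

/-- Decay holds because the projection of a circle to a line has a density. This is why each factor
must contain a plane: the zero-dimensional sphere has transform `cos r`, which does not decay. -/
lemma tendsto_circleTransform : Tendsto circleTransform atTop (𝓝 0) := by
  have h1 := Real.tendsto_integral_exp_smul_cocompact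
    ((Real.cos '' Set.Ioo 0 Real.pi).indicator (fun u => ((√(1 - u ^ 2))⁻¹ : ℂ)))
  simp_rw [integral_comp_cos] at h1
  have h2 : Tendsto (fun r : ℝ => (2 * Real.pi)⁻¹ * r) atTop (cocompact ℝ) :=
    (tendsto_id.const_mul_atTop (by positivity)).mono_right atTop_le_cocompact
  have h3 := (Complex.continuous_re.tendsto _).comp (h1.comp h2)
  have h4 := h3.const_mul Real.pi⁻¹
  simp only [Complex.zero_re, mul_zero] at h4
  refine h4.congr fun r => ?_
  simp only [Function.comp_apply, circleTransform]
  congr 1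
  have hi : IntegrableOn (fun t => (Real.fourierChar
      (-(Real.cos t * ((2 * Real.pi)⁻¹ * r))) : ℂ)) (Set.Ioo 0 Real.pi) := by
    refine (Continuous.integrableOn_Icc ?_).mono_set Set.Ioo_subset_Icc_self
    simp only [Real.fourierChar_apply]
    fun_prop
  have := integral_re hi
  simp only [RCLike.re_eq_complex_re] at this
  rw [← this, intervalIntegral.integral_of_le Real.pi_pos.le, integral_Ioc_eq_integral_Ioo]
  refine setIntegral_congr_fun measurableSet_Ioo fun t _ => ?_
  simp only [Real.fourierChar_apply, Complex.exp_ofReal_mul_I_re]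
  rw [← Real.cos_neg]
  congr 1
  field_simp

/-- The circle transform is controlled by a heat kernel up to a small error and a multiple of a
difference of heat kernels. -/
lemma exists_circleTransform_sub_le {ε : ℝ} (hε : 0 < ε) :
    ∃ K : ℝ, 0 ≤ K ∧ ∀ r : ℝ, 0 ≤ r → |circleTransform r - Real.exp (-r ^ 2)| ≤
      ε + K * (Real.exp (-(r / 2) ^ 2) - Real.exp (-r ^ 2)) := by
  set h : ℝ → ℝ := fun r => |circleTransform r - Real.exp (-r ^ 2)| with hh
  have hc : Continuous h := (continuous_circleTransform.sub (by fun_prop)).abs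
  have h0 : h 0 = 0 := by simp [hh, circleTransform_zero]
  have hD : ∀ r : ℝ, 0 ≤ Real.exp (-(r / 2) ^ 2) - Real.exp (-r ^ 2) := fun r =>
    sub_nonneg.2 (Real.exp_le_exp.2 (by nlinarith [sq_nonneg r]))
  have h1 : ∀ᶠ r in 𝓝 0, h r < ε := hc.continuousAt.eventually_lt_const (by rwa [h0])
  obtain ⟨k, hk, hk'⟩ := Metric.eventually_nhds_iff.1 h1
  have h2 : Tendsto h atTop (𝓝 0) := by
    have e1 : Tendsto (fun r : ℝ => Real.exp (-r ^ 2)) atTop (𝓝 0) :=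
      Real.tendsto_exp_neg_atTop_nhds_zero.comp (tendsto_pow_atTop two_ne_zero)
    simpa [hh] using (tendsto_circleTransform.sub e1).abs
  obtain ⟨R, hR⟩ := eventually_atTop.1 (h2.eventually_lt_const hε)
  -- The error is below `ε` for `r < k` by continuity and for `r ≥ R` by decay. On the compact range
  -- in between, the heat difference has a positive minimum `D`, and since the error is at most `2`,
  -- the constant `K = 2 / D` works; if the two outer ranges overlap, `K = 0` does.
  obtain hlt | hle := lt_or_ge R k
  · refine ⟨0, le_rfl, fun r hr => ?_⟩
    rw [zero_mul, add_zero]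
    obtain h3 | h3 := lt_or_ge r k
    · exact (hk' (by simpa [abs_of_nonneg hr] using h3)).le
    · exact (hR r (hlt.le.trans h3)).le
  · obtain ⟨x, hx, hx'⟩ := isCompact_Icc.exists_isMinOn (Set.nonempty_Icc.2 hle)
      (f := fun r : ℝ => Real.exp (-(r / 2) ^ 2) - Real.exp (-r ^ 2)) (by fun_prop)
    set D := Real.exp (-(x / 2) ^ 2) - Real.exp (-x ^ 2) with hDdef
    have hDpos : 0 < D := sub_pos.2 (Real.exp_lt_exp.2 (by
      have : 0 < x := hk.trans_le hx.1
      nlinarith [sq_pos_of_pos this]))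
    refine ⟨2 / D, by positivity, fun r hr => ?_⟩
    obtain h3 | h3 := lt_or_ge r k
    · exact (hk' (by simpa [abs_of_nonneg hr] using h3)).le.trans
        (le_add_of_nonneg_right (mul_nonneg (by positivity) (hD r)))
    obtain h4 | h4 := lt_or_ge R r
    · exact (hR r h4.le).le.trans
        (le_add_of_nonneg_right (mul_nonneg (by positivity) (hD r)))
    have h5 : D ≤ Real.exp (-(r / 2) ^ 2) - Real.exp (-r ^ 2) := hx' ⟨h3, h4⟩
    have h6 : h r ≤ 2 := by
      refine (abs_sub _ _).trans ?_
      have a := abs_circleTransform_le r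
      have b : |Real.exp (-r ^ 2)| ≤ 1 := by
        rw [abs_of_pos (Real.exp_pos _)]
        exact Real.exp_le_one_iff.2 (by nlinarith [sq_nonneg r])
      linarith
    calc h r ≤ 2 := h6
      _ = 2 / D * D := by field_simp
      _ ≤ 2 / D * (Real.exp (-(r / 2) ^ 2) - Real.exp (-r ^ 2)) := by gcongr
      _ ≤ _ := le_add_of_nonneg_left hε.le

/-- The point of the circle of radius `s` with angle `π θ`. -/
def circlePoint (s θ : ℝ) : ℂ := s * Complex.exp ((Real.pi * θ : ℝ) * Complex.I)

/-- The uniform probability measure on a half circle of radius `s` centred at the origin. -/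
def circ (s : ℝ) : Measure ℂ := (volume.restrict (Set.Ioc (0 : ℝ) 1)).map (circlePoint s)

/-- The law of `s (Z - Z')`, for independent standard Gaussian variables `Z`, `Z'` in the plane. -/
def heat (s : ℝ) : Measure ℂ :=
  ((stdGaussian ℂ).prod (stdGaussian ℂ)).map fun p => (s : ℂ) * (p.1 - p.2)

lemma measurable_circlePoint (s : ℝ) : Measurable (circlePoint s) := by
  unfold circlePoint; fun_prop

instance (s : ℝ) : IsProbabilityMeasure (circ s) := by
  have : IsProbabilityMeasure (volume.restrict (Set.Ioc (0 : ℝ) 1)) := ⟨by simp⟩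
  exact Measure.isProbabilityMeasure_map (measurable_circlePoint s).aemeasurable

instance (s : ℝ) : IsProbabilityMeasure (heat s) :=
  Measure.isProbabilityMeasure_map (by fun_prop)

/-- In polar coordinates the argument of `η` only rotates the parameter, and `cos (r cos t)` has
period `π`. The same evenness is why half a circle suffices. -/
lemma integral_cos_circ {s : ℝ} (η : ℂ) :
    ∫ z, Real.cos (inner ℝ z η) ∂(circ s) = circleTransform (s * ‖η‖) := by
  rw [circ, integral_map (measurable_circlePoint s).aemeasurable (by fun_prop)]
  have h1 : ∀ θ : ℝ, inner ℝ (circlePoint s θ) η =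
      s * ‖η‖ * Real.cos (Real.pi * θ - Complex.arg η) := by
    intro θ
    have hre : (circlePoint s θ).re = s * Real.cos (Real.pi * θ) := by
      rw [circlePoint, Complex.re_ofReal_mul, Complex.exp_ofReal_mul_I_re]
    have him : (circlePoint s θ).im = s * Real.sin (Real.pi * θ) := by
      rw [circlePoint, Complex.im_ofReal_mul, Complex.exp_ofReal_mul_I_im]
    rw [Complex.inner, Complex.mul_re, Complex.conj_re, Complex.conj_im, hre, him, Real.cos_sub]
    conv_lhs => rw [← Complex.norm_mul_cos_arg η, ← Complex.norm_mul_sin_arg η]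
    ring
  simp_rw [h1]
  rw [← intervalIntegral.integral_of_le zero_le_one, circleTransform]
  have h2 := intervalIntegral.integral_comp_mul_sub (a := 0) (b := 1)
    (fun t => Real.cos (s * ‖η‖ * Real.cos t)) Real.pi_ne_zero (Complex.arg η)
  rw [h2, smul_eq_mul]
  congr 1
  have hp : Function.Periodic (fun t => Real.cos (s * ‖η‖ * Real.cos t)) Real.pi := by
    intro t
    simp only [Real.cos_add_pi, mul_neg, Real.cos_neg]
  have h3 := hp.intervalIntegral_add_eq (Real.pi * 0 - Complex.arg η) 0
  rw [zero_add] at h3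
  rw [← h3]
  congr 1
  ring

lemma integral_cos_eq_re_charFun (μ : Measure ℂ) [IsFiniteMeasure μ] (η : ℂ) :
    ∫ z, Real.cos (inner ℝ z η) ∂μ = (charFun μ η).re := by
  have hi : Integrable (fun z : ℂ => Complex.exp ((inner ℝ z η : ℝ) * Complex.I)) μ :=
    (integrable_const (1 : ℝ)).mono' (by fun_prop)
      (Eventually.of_forall fun z => (Complex.norm_exp_ofReal_mul_I _).le)
  have := integral_re hi
  simp only [RCLike.re_eq_complex_re, Complex.exp_ofReal_mul_I_re] at this
  rw [this, charFun_apply]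

/-- The two independent Gaussians contribute `exp (-(s‖η‖)² / 2)` each. Using a difference of two
points, rather than a single Gaussian, is what later turns heat averages into box norms. -/
lemma integral_cos_heat {s : ℝ} (η : ℂ) :
    ∫ z, Real.cos (inner ℝ z η) ∂(heat s) = Real.exp (-(s * ‖η‖) ^ 2) := by
  rw [integral_cos_eq_re_charFun, charFun_apply, heat, integral_map (by fun_prop) (by fun_prop)]
  have h1 : ∀ p : ℂ × ℂ, Complex.exp ((inner ℝ ((s : ℂ) * (p.1 - p.2)) η : ℝ) * Complex.I) =
      Complex.exp ((inner ℝ p.1 (s • η) : ℝ) * Complex.I) *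
        Complex.exp ((inner ℝ p.2 (-(s • η)) : ℝ) * Complex.I) := by
    intro p
    rw [← Complex.exp_add, ← Complex.real_smul (x := s) (z := p.1 - p.2)]
    congr 1
    rw [real_inner_smul_left, inner_sub_left, inner_neg_right, real_inner_smul_right,
      real_inner_smul_right]
    push_cast
    ring
  simp_rw [h1]
  rw [integral_prod_mul (fun z : ℂ => Complex.exp ((inner ℝ z (s • η) : ℝ) * Complex.I))
    (fun z : ℂ => Complex.exp ((inner ℝ z (-(s • η)) : ℝ) * Complex.I)), ← charFun_apply,
    ← charFun_apply, charFun_stdGaussian, charFun_stdGaussian, norm_neg, ← Complex.exp_add]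
  have : (-(‖s • η‖ : ℂ) ^ 2 / 2 + -(‖s • η‖ : ℂ) ^ 2 / 2) = ((-(s * ‖η‖) ^ 2 : ℝ) : ℂ) := by
    rw [norm_smul, Real.norm_eq_abs]
    push_cast
    rw [mul_pow, ← Complex.ofReal_pow, sq_abs]
    push_cast; ring
  rw [this, ← Complex.ofReal_exp, Complex.ofReal_re]

/-- `c` is the cosine transform of a finite measure. -/
def IsSpectral (c : ℂ → ℝ) : Prop :=
  ∃ m : Measure ℂ, IsFiniteMeasure m ∧ ∀ z, c z = ∫ η, Real.cos (inner ℝ z η) ∂m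

lemma integral_cosTransform (m μ : Measure ℂ) [IsFiniteMeasure m] [IsFiniteMeasure μ] :
    ∫ z, ∫ η, Real.cos (inner ℝ z η) ∂m ∂μ = ∫ η, ∫ z, Real.cos (inner ℝ z η) ∂μ ∂m := by
  refine integral_integral_swap ?_
  refine (integrable_const (1 : ℝ)).mono' (Continuous.aestronglyMeasurable (by fun_prop))
    (Eventually.of_forall fun z => Real.abs_cos_le_one _)

lemma integrable_exp_neg_sq (m : Measure ℂ) [IsFiniteMeasure m] (s : ℝ) :
    Integrable (fun η => Real.exp (-(s * ‖η‖) ^ 2)) m :=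
  (integrable_const (1 : ℝ)).mono' (Continuous.aestronglyMeasurable (by fun_prop))
    (Eventually.of_forall fun z => by
      rw [Real.norm_eq_abs, abs_of_pos (Real.exp_pos _)]
      exact Real.exp_le_one_iff.2 (by nlinarith [sq_nonneg (s * ‖z‖)]))

/-- The multiplier decreases pointwise in the scale, and the spectral measure is positive. -/
lemma IsSpectral.integral_heat_anti {c : ℂ → ℝ} (hc : IsSpectral c) {s t : ℝ} (hs : 0 ≤ s)
    (hst : s ≤ t) : ∫ z, c z ∂(heat t) ≤ ∫ z, c z ∂(heat s) := by
  obtain ⟨m, hm, h⟩ := hc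
  simp_rw [h, integral_cosTransform, integral_cos_heat]
  refine integral_mono (integrable_exp_neg_sq m t) (integrable_exp_neg_sq m s) fun η => ?_
  refine Real.exp_le_exp.2 (neg_le_neg ?_)
  gcongr

/-- The multiplier inequality is integrated against the spectral measure, whose total mass is `c 0`.
The constant `K` depends only on `ε`, not on `c` or `s`. -/
lemma exists_abs_circ_sub_heat_le {ε : ℝ} (hε : 0 < ε) :
    ∃ K : ℝ, 0 ≤ K ∧ ∀ c : ℂ → ℝ, IsSpectral c → ∀ s : ℝ, 0 ≤ s →
      |∫ z, c z ∂(circ s) - ∫ z, c z ∂(heat s)| ≤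
        ε * c 0 + K * (∫ z, c z ∂(heat (s / 2)) - ∫ z, c z ∂(heat s)) := by
  obtain ⟨K, hK, hKb⟩ := exists_circleTransform_sub_le hε
  refine ⟨K, hK, fun c ⟨m, hm, h⟩ s hs => ?_⟩
  have h0 : c 0 = ∫ _η, (1 : ℝ) ∂m := by rw [h]; simp
  rw [h0]
  simp_rw [h, integral_cosTransform, integral_cos_heat, integral_cos_circ]
  have i1 : Integrable (fun η => circleTransform (s * ‖η‖)) m :=
    (integrable_const (1 : ℝ)).mono'
      (continuous_circleTransform.comp (by fun_prop)).aestronglyMeasurable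
      (Eventually.of_forall fun z => abs_circleTransform_le _)
  have i2 := integrable_exp_neg_sq m s
  have i3 := integrable_exp_neg_sq m (s / 2)
  have i4 : Integrable (fun η => K * (Real.exp (-(s / 2 * ‖η‖) ^ 2)
    - Real.exp (-(s * ‖η‖) ^ 2))) m := (i3.sub i2).const_mul K
  rw [← integral_sub i1 i2, ← integral_sub i3 i2, ← integral_const_mul, ← integral_const_mul,
    ← integral_add ((integrable_const _).const_mul _) i4]
  rw [← Real.norm_eq_abs]
  refine norm_integral_le_of_norm_le (((integrable_const _).const_mul _).add i4)
    (Eventually.of_forall fun η => ?_)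
  have := hKb (s * ‖η‖) (by positivity)
  rw [Real.norm_eq_abs, mul_one]
  convert this using 6
  ring

end CircleAndHeat

/-! ### Kernels in two variables and the choice of a good scale -/

section Kernel

/-- A measurable kernel with values in `[0, M]` which is a cosine transform of a finite measure in
each variable. -/
structure IsBispectral (C : ℂ → ℂ → ℝ) (M : ℝ) : Prop where
  measurable : Measurable (Function.uncurry C)
  nonneg : ∀ z w, 0 ≤ C z w
  le : ∀ z w, C z w ≤ M
  left : ∀ w, IsSpectral fun z => C z w
  right : ∀ z, IsSpectral fun w => C z w

/-- The average of a kernel over a pair of measures. -/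
def form (C : ℂ → ℂ → ℝ) (μ ν : Measure ℂ) : ℝ := ∫ w, ∫ z, C z w ∂μ ∂ν

namespace IsBispectral

variable {C : ℂ → ℂ → ℝ} {M : ℝ}

lemma swap (h : IsBispectral C M) : IsBispectral (fun z w => C w z) M where
  measurable := h.measurable.comp measurable_swap
  nonneg z w := h.nonneg w z
  le z w := h.le w z
  left := h.right
  right := h.left

lemma integrable_prod (h : IsBispectral C M) (μ : Measure (ℂ × ℂ)) [IsFiniteMeasure μ] :
    Integrable (Function.uncurry C) μ :=
  (integrable_const M).mono' h.measurable.aestronglyMeasurable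
    (Eventually.of_forall fun p => by
      rw [Function.uncurry_def, Real.norm_eq_abs, abs_of_nonneg (h.nonneg _ _)]
      exact h.le _ _)

lemma integrable_left (h : IsBispectral C M) (μ : Measure ℂ) [IsFiniteMeasure μ] (w : ℂ) :
    Integrable (fun z => C z w) μ :=
  (integrable_const M).mono' (h.measurable.comp measurable_prodMk_right).aestronglyMeasurable
    (Eventually.of_forall fun p => by
      rw [Real.norm_eq_abs, abs_of_nonneg (h.nonneg _ _)]
      exact h.le _ _)

lemma integrable_integral (h : IsBispectral C M) (μ ν : Measure ℂ) [IsFiniteMeasure μ]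
    [IsFiniteMeasure ν] : Integrable (fun w => ∫ z, C z w ∂μ) ν :=
  (h.swap.integrable_prod (ν.prod μ)).integral_prod_left

lemma form_swap (h : IsBispectral C M) (μ ν : Measure ℂ) [IsFiniteMeasure μ]
    [IsFiniteMeasure ν] : form C μ ν = form (fun z w => C w z) ν μ :=
  integral_integral_swap (h.swap.integrable_prod (ν.prod μ))

lemma form_nonneg (h : IsBispectral C M) (μ ν : Measure ℂ) : 0 ≤ form C μ ν :=
  integral_nonneg fun w => integral_nonneg fun z => h.nonneg z w

lemma form_le (h : IsBispectral C M) (μ ν : Measure ℂ) [IsProbabilityMeasure μ]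
    [IsProbabilityMeasure ν] : form C μ ν ≤ M := by
  have h1 : ∀ w, ∫ z, C z w ∂μ ≤ M := fun w => by
    refine (integral_mono (h.integrable_left μ w) (integrable_const M) fun z => h.le z w).trans ?_
    simp
  refine (integral_mono (h.integrable_integral μ ν) (integrable_const M) h1).trans ?_
  simp

lemma form_heat_anti_left (h : IsBispectral C M) (ν : Measure ℂ) [IsProbabilityMeasure ν]
    {s t : ℝ} (hs : 0 ≤ s) (hst : s ≤ t) : form C (heat t) ν ≤ form C (heat s) ν :=
  integral_mono (h.integrable_integral _ _) (h.integrable_integral _ _)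
    fun w => (h.left w).integral_heat_anti hs hst

lemma form_heat_anti_right (h : IsBispectral C M) (μ : Measure ℂ) [IsProbabilityMeasure μ]
    {s t : ℝ} (hs : 0 ≤ s) (hst : s ≤ t) : form C μ (heat t) ≤ form C μ (heat s) := by
  rw [h.form_swap, h.form_swap μ (heat s)]
  exact h.swap.form_heat_anti_left μ hs hst

lemma form_heat_anti (h : IsBispectral C M) {a b s t : ℝ} (ha : 0 ≤ a) (hb : 0 ≤ b)
    (hs : 0 ≤ s) (hst : s ≤ t) :
    form C (heat (t * a)) (heat (t * b)) ≤ form C (heat (s * a)) (heat (s * b)) :=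
  (h.form_heat_anti_left _ (mul_nonneg hs ha) (by gcongr)).trans
    (h.form_heat_anti_right _ (mul_nonneg hs hb) (by gcongr))

end IsBispectral

lemma exists_abs_form_circ_sub_heat_le {ε : ℝ} (hε : 0 < ε) :
    ∃ K : ℝ, 0 ≤ K ∧ ∀ (C : ℂ → ℂ → ℝ) (M : ℝ), IsBispectral C M →
      ∀ (ν : Measure ℂ) [IsProbabilityMeasure ν] (s : ℝ), 0 ≤ s →
      |form C (circ s) ν - form C (heat s) ν| ≤
        ε * M + K * (form C (heat (s / 2)) ν - form C (heat s) ν) := by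
  obtain ⟨K, hK, hKb⟩ := exists_abs_circ_sub_heat_le hε
  refine ⟨K, hK, fun C M h ν _ s hs => ?_⟩
  have i1 := h.integrable_integral (circ s) ν
  have i2 := h.integrable_integral (heat s) ν
  have i3 := h.integrable_integral (heat (s / 2)) ν
  unfold form
  have i5 : Integrable (fun w => K * (∫ z, C z w ∂(heat (s / 2)) - ∫ z, C z w ∂(heat s))) ν :=
    (i3.sub i2).const_mul K
  have i4 : Integrable (fun w => ε * M + K * (∫ z, C z w ∂(heat (s / 2))
      - ∫ z, C z w ∂(heat s))) ν := (integrable_const _).add i5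
  have h1 : ∫ w, (ε * M + K * (∫ z, C z w ∂(heat (s / 2)) - ∫ z, C z w ∂(heat s))) ∂ν
      = ε * M + K * (∫ w, ∫ z, C z w ∂(heat (s / 2)) ∂ν - ∫ w, ∫ z, C z w ∂(heat s) ∂ν) := by
    rw [integral_add (integrable_const _) i5, integral_const_mul K,
      integral_sub i3 i2]
    simp
  rw [← h1, ← integral_sub i1 i2, ← Real.norm_eq_abs]
  refine norm_integral_le_of_norm_le i4 (Eventually.of_forall fun w => ?_)
  refine (hKb _ (h.left w) s hs).trans ?_
  gcongr
  exact h.le 0 w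

/-- The average over a pair of circles is bounded below by a heat average, up to a small error and
a multiple of the difference of heat averages at comparable scales. -/
lemma exists_form_circ_ge {ε : ℝ} (hε : 0 < ε) :
    ∃ K : ℝ, 0 ≤ K ∧ ∀ (C : ℂ → ℂ → ℝ) (M : ℝ), IsBispectral C M →
      ∀ (a b s : ℝ), 0 ≤ a → 0 ≤ b → 0 ≤ s →
      form C (heat (s * a)) (heat (s * b)) - ε * M - K *
        (form C (heat (s / 2 * a)) (heat (s / 2 * b)) - form C (heat (s * a)) (heat (s * b)))
        ≤ form C (circ (s * a)) (circ (s * b)) := by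
  obtain ⟨K₁, hK₁, h₁⟩ := exists_abs_form_circ_sub_heat_le (half_pos hε)
  obtain ⟨K₂, hK₂, h₂⟩ := exists_abs_form_circ_sub_heat_le
    -- After the first variable is treated, the second must be replaced once with weight `1 + K₁`
    -- and once with weight `K₁`; this tolerance makes those errors add up to `ε / 2`.
    (ε := ε / 2 / (1 + 2 * K₁)) (by positivity)
  refine ⟨K₁ * (1 + 2 * K₂) + K₂, by positivity, fun C M h a b s ha hb hs => ?_⟩
  set δ := ε / 2 / (1 + 2 * K₁) with hδ
  have hδ' : δ * (1 + 2 * K₁) = ε / 2 := by rw [hδ]; field_simp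
  have right : ∀ μ : Measure ℂ, IsProbabilityMeasure μ →
      |form C μ (circ (s * b)) - form C μ (heat (s * b))| ≤
        δ * M + K₂ * (form C μ (heat (s * b / 2)) - form C μ (heat (s * b))) := by
    intro μ _
    rw [h.form_swap, h.form_swap μ, h.form_swap μ (heat (s * b / 2))]
    exact h₂ _ M h.swap μ _ (by positivity)
  have e1 := h₁ C M h (circ (s * b)) (s * a) (by positivity)
  have e2 := right (heat (s * a)) inferInstance
  have e3 := right (heat (s * a / 2)) inferInstance
  have ea : s / 2 * a = s * a / 2 := by ring
  have eb : s / 2 * b = s * b / 2 := by ring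
  rw [ea, eb]
  have sa : 0 ≤ s * a := by positivity
  have sb : 0 ≤ s * b := by positivity
  have m1 : form C (heat (s * a)) (heat (s * b)) ≤ form C (heat (s * a / 2)) (heat (s * b)) :=
    h.form_heat_anti_left _ (by positivity) (by linarith)
  have m2 : form C (heat (s * a / 2)) (heat (s * b)) ≤
      form C (heat (s * a / 2)) (heat (s * b / 2)) :=
    h.form_heat_anti_right _ (by positivity) (by linarith)
  have m3 : form C (heat (s * a)) (heat (s * b / 2)) ≤
      form C (heat (s * a / 2)) (heat (s * b / 2)) :=
    h.form_heat_anti_left _ (by positivity) (by linarith)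
  set F := form C (heat (s * a)) (heat (s * b))
  set F' := form C (heat (s * a / 2)) (heat (s * b / 2))
  have b1 : form C (heat (s * a)) (circ (s * b)) ≥ F - δ * M - K₂ * (F' - F) := by
    have := mul_le_mul_of_nonneg_left (sub_le_sub_right m3 F) hK₂
    linarith [(abs_le.1 e2).1]
  have b2 : form C (heat (s * a / 2)) (circ (s * b)) ≤ F' + δ * M + K₂ * (F' - F) := by
    have := mul_le_mul_of_nonneg_left (sub_le_sub_left m1 F') hK₂
    linarith [(abs_le.1 e3).2]
  have b3 := mul_le_mul_of_nonneg_left (sub_le_sub b2 b1) hK₁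
  have b4 : δ * M * (1 + 2 * K₁) = ε / 2 * M := by rw [← hδ']; ring
  linarith [(abs_le.1 e1).1]

/-- A bounded nonincreasing function varies little around one of many lacunary scales. -/
lemma exists_small_drop {F : ℝ → ℝ} {M : ℝ} (hF0 : ∀ s, 0 ≤ F s) (hFM : ∀ s, F s ≤ M)
    (hF : ∀ s t, 0 ≤ s → s ≤ t → F t ≤ F s) {l : ℕ → ℝ} (hl : ∀ j, 0 ≤ l j)
    (hl2 : ∀ j, 2 * l j ≤ l (j + 1)) {J : ℕ} (hJ : 0 < J) :
    ∃ j < J, J * (F (l j / 2) - F (l j)) ≤ M := by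
  -- The intervals `[l j / 2, l j]` do not overlap beyond endpoints, so by monotonicity the drops
  -- over them telescope.
  have h1 : ∀ n, ∑ j ∈ Finset.range n, (F (l j / 2) - F (l j)) + F (l n / 2) ≤ M := by
    intro n
    induction n with
    | zero => simpa using hFM _
    | succ n ih =>
      rw [Finset.sum_range_succ]
      have := hF (l n) (l (n + 1) / 2) (hl n) (by linarith [hl2 n])
      linarith
  by_contra! hcon
  have h2 : ∑ j ∈ Finset.range J, M / J < ∑ j ∈ Finset.range J, (F (l j / 2) - F (l j)) := by
    refine Finset.sum_lt_sum_of_nonempty (by simpa using hJ.ne') fun j hj => ?_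
    rw [div_lt_iff₀ (by exact_mod_cast hJ), mul_comm]
    exact hcon j (Finset.mem_range.1 hj)
  rw [Finset.sum_const, Finset.card_range, nsmul_eq_mul,
    mul_div_cancel₀ _ (by exact_mod_cast hJ.ne')] at h2
  linarith [h1 J, hF0 (l J / 2)]

end Kernel

/-! ### Parallelogram counts and their lower bound by box norms -/

section Correlation

open ProbabilityTheory

variable {V : Type*} [NormedAddCommGroup V] [InnerProductSpace ℝ V] [FiniteDimensional ℝ V]
  [MeasurableSpace V] [BorelSpace V]

/-- The number of parallelograms with sides `u` and `w`, weighted by `f`. -/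
def corr (f : V → ℝ) (u w : V) : ℝ := ∫ v, f v * f (v + w) * (f (v + u) * f (v + u + w))

lemma corr_comm (f : V → ℝ) (u w : V) : corr f u w = corr f w u := by
  unfold corr
  congr 1 with v
  rw [add_right_comm]
  ring

/-- The autocorrelation of a square integrable function along a plane is spectral. -/
lemma isSpectral_autocorrelation {g : V → ℝ} (hg : MemLp g 2 (volume : Measure V))
    (ι : ℂ →L[ℝ] V) : IsSpectral fun z => ∫ v, g v * g (v + ι z) := by
  obtain ⟨m, hm, h⟩ := exists_spectral_measure hg
  have hmeas : Measurable (ContinuousLinearMap.adjoint ι) :=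
    (ContinuousLinearMap.adjoint ι).continuous.measurable
  refine ⟨m.map (ContinuousLinearMap.adjoint ι), inferInstance, fun z => ?_⟩
  simp only [h]
  rw [integral_map hmeas.aemeasurable (by fun_prop)]
  simp_rw [ContinuousLinearMap.adjoint_inner_right]

variable {f : V → ℝ}

/-- With `w` frozen the count is the autocorrelation of `f · f(· + ι₂ w)`, which is square
integrable because its square is at most `f`. The symmetry `corr_comm` handles the other variable.
-/
lemma isBispectral_corr (hf : Measurable f) (hi : Integrable f) (h0 : ∀ v, 0 ≤ f v)
    (h1 : ∀ v, f v ≤ 1) (ι₁ ι₂ : ℂ →L[ℝ] V) :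
    IsBispectral (fun z w => corr f (ι₁ z) (ι₂ w)) (∫ v, f v) := by
  have key : ∀ (ι₁ ι₂ : ℂ →L[ℝ] V) (w : ℂ), IsSpectral fun z => corr f (ι₁ z) (ι₂ w) := by
    intro ι₁ ι₂ w
    have hm : Measurable fun v => f v * f (v + ι₂ w) := by fun_prop
    refine isSpectral_autocorrelation (g := fun v => f v * f (v + ι₂ w)) ?_ ι₁
    refine (memLp_two_iff_integrable_sq hm.aestronglyMeasurable).2 ?_
    refine hi.mono' (by fun_prop) (Eventually.of_forall fun v => ?_)
    rw [Real.norm_eq_abs, abs_of_nonneg (sq_nonneg _)]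
    have a := h0 v
    have b := h0 (v + ι₂ w)
    calc (f v * f (v + ι₂ w)) ^ 2 = f v * (f v * f (v + ι₂ w) ^ 2) := by ring
      _ ≤ f v * (1 * 1 ^ 2) := by gcongr <;> exact h1 _
      _ = f v := by ring
  refine ⟨?_, fun z w => ?_, fun z w => ?_, fun w => key ι₁ ι₂ w, fun z => ?_⟩
  · have : Measurable (fun q : (ℂ × ℂ) × V => f q.2 * f (q.2 + ι₂ q.1.2) *
        (f (q.2 + ι₁ q.1.1) * f (q.2 + ι₁ q.1.1 + ι₂ q.1.2))) := by fun_prop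
    exact this.stronglyMeasurable.integral_prod_right.measurable
  · exact integral_nonneg fun v => mul_nonneg (mul_nonneg (h0 _) (h0 _)) (mul_nonneg (h0 _) (h0 _))
  · refine integral_mono_of_nonneg (Eventually.of_forall fun v =>
      mul_nonneg (mul_nonneg (h0 _) (h0 _)) (mul_nonneg (h0 _) (h0 _))) hi
      (Eventually.of_forall fun v => ?_)
    have a := h0 v
    have b := h0 (v + ι₂ w)
    have c := h0 (v + ι₁ z)
    have d := h0 (v + ι₁ z + ι₂ w)
    calc f v * f (v + ι₂ w) * (f (v + ι₁ z) * f (v + ι₁ z + ι₂ w))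
        ≤ f v * 1 * (1 * 1) := by gcongr <;> exact h1 _
      _ = f v := by ring
  · simp_rw [corr_comm f (ι₁ z)]
    exact key ι₂ ι₁ z

/-- Cauchy–Schwarz against the constant function `1`. -/
lemma sq_integral_le {α : Type*} [MeasurableSpace α] (μ : Measure α) [IsFiniteMeasure μ]
    {g : α → ℝ} (hg : Measurable g) {B : ℝ} (hB : ∀ x, |g x| ≤ B) :
    (∫ x, g x ∂μ) ^ 2 ≤ μ.real Set.univ * ∫ x, g x ^ 2 ∂μ := by
  have i1 : Integrable g μ := (integrable_const B).mono' hg.aestronglyMeasurable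
    (Eventually.of_forall hB)
  have i2 : Integrable (fun x => g x ^ 2) μ := (integrable_const (B ^ 2)).mono'
    (hg.pow_const 2).aestronglyMeasurable (Eventually.of_forall fun x => by
      rw [Real.norm_eq_abs, abs_pow]
      exact pow_le_pow_left₀ (abs_nonneg _) (hB x) 2)
  -- The quadratic in `c` is `∫ (g - c)²`, which is never negative.
  have h := discrim_le_zero (a := μ.real Set.univ) (b := -2 * ∫ x, g x ∂μ)
    (c := ∫ x, g x ^ 2 ∂μ) fun c => by
    have h1 : 0 ≤ ∫ x, (g x - c) ^ 2 ∂μ := integral_nonneg fun x => sq_nonneg _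
    have h2 : ∀ x, (g x - c) ^ 2 = g x ^ 2 - 2 * c * g x + c ^ 2 := fun x => by ring
    have i3 : Integrable (fun x => g x ^ 2 - 2 * c * g x) μ := i2.sub (i1.const_mul _)
    simp_rw [h2] at h1
    rw [integral_add i3 (integrable_const _), integral_sub i2 (i1.const_mul _),
      integral_const_mul, integral_const, smul_eq_mul] at h1
    linarith
  rw [discrim] at h
  linarith

lemma abs_integral_le_one {α : Type*} [MeasurableSpace α] (μ : Measure α)
    [IsProbabilityMeasure μ] {g : α → ℝ} (hg : ∀ x, |g x| ≤ 1) : |∫ x, g x ∂μ| ≤ 1 := by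
  simpa using norm_integral_le_of_norm_le_const (μ := μ) (f := g) (C := 1)
    (Eventually.of_forall hg)

/-- The box-norm inequality on a product of probability spaces. -/
lemma box_inequality {X Y : Type*} [MeasurableSpace X] [MeasurableSpace Y] (μ : Measure X)
    (ν : Measure Y) [IsProbabilityMeasure μ] [IsProbabilityMeasure ν] {h : X → Y → ℝ}
    (hm : Measurable (Function.uncurry h)) (h0 : ∀ x y, 0 ≤ h x y) (h1 : ∀ x y, h x y ≤ 1) :
    (∫ x, ∫ y, h x y ∂ν ∂μ) ^ 4 ≤
      ∫ q : Y × Y, ∫ p : X × X,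
        (h p.1 q.1 * h p.1 q.2) * (h p.2 q.1 * h p.2 q.2) ∂(μ.prod μ) ∂(ν.prod ν) := by
  have habs : ∀ x y, |h x y| ≤ 1 := fun x y => abs_le.2 ⟨by linarith [h0 x y], h1 x y⟩
  have hk0 : ∀ x (q : Y × Y), |h x q.1 * h x q.2| ≤ 1 := fun x q => by
    rw [abs_mul]; exact mul_le_one₀ (habs _ _) (abs_nonneg _) (habs _ _)
  have hk : Measurable fun r : (Y × Y) × X => h r.2 r.1.1 * h r.2 r.1.2 :=
    (hm.comp (measurable_snd.prodMk (measurable_fst.comp measurable_fst))).mul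
      (hm.comp (measurable_snd.prodMk (measurable_snd.comp measurable_fst)))
  have hK : Measurable fun q : Y × Y => ∫ x, h x q.1 * h x q.2 ∂μ :=
    hk.stronglyMeasurable.integral_prod_right.measurable
  have hI : Measurable fun x => ∫ y, h x y ∂ν :=
    hm.stronglyMeasurable.integral_prod_right.measurable
  have e1 : ∀ q : Y × Y, ∫ p : X × X, (h p.1 q.1 * h p.1 q.2) * (h p.2 q.1 * h p.2 q.2)
      ∂(μ.prod μ) = (∫ x, h x q.1 * h x q.2 ∂μ) ^ 2 := fun q => by
    rw [integral_prod_mul (fun x => h x q.1 * h x q.2) (fun x => h x q.1 * h x q.2), sq]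
  have e2 : ∫ q : Y × Y, ∫ x, h x q.1 * h x q.2 ∂μ ∂(ν.prod ν) = ∫ x, (∫ y, h x y ∂ν) ^ 2 ∂μ := by
    rw [integral_integral_swap]
    · congr 1 with x
      rw [integral_prod_mul (fun y => h x y) (fun y => h x y), sq]
    · exact (integrable_const (1 : ℝ)).mono' hk.aestronglyMeasurable
        (Eventually.of_forall fun r => hk0 _ _)
  -- Cauchy–Schwarz is applied twice: in `x`, which doubles `y`, and then in the pair of `y`'s,
  -- which doubles `x`.
  have s1 := sq_integral_le μ hI (B := 1) fun x => abs_integral_le_one ν (habs x)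
  have s2 := sq_integral_le (ν.prod ν) hK (B := 1) fun q => abs_integral_le_one μ fun x => hk0 x q
  simp_rw [e1]
  rw [e2] at s2
  rw [probReal_univ, one_mul] at s1 s2
  calc (∫ x, ∫ y, h x y ∂ν ∂μ) ^ 4 = ((∫ x, ∫ y, h x y ∂ν ∂μ) ^ 2) ^ 2 := by ring
    _ ≤ (∫ x, (∫ y, h x y ∂ν) ^ 2 ∂μ) ^ 2 := by gcongr
    _ ≤ _ := s2

/-- The vector with components `s z` along the first plane and `t w` along the second one. -/
def shift (ι₁ ι₂ : ℂ →L[ℝ] V) (s t : ℝ) (z w : ℂ) : V := ι₁ (s * z) + ι₂ (t * w)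

lemma measurable_shift (ι₁ ι₂ : ℂ →L[ℝ] V) (s t : ℝ) :
    Measurable (Function.uncurry (shift ι₁ ι₂ s t)) := by
  unfold shift Function.uncurry
  fun_prop

lemma integrable_comp_add_prod {Ω : Type*} [MeasurableSpace Ω] (P : Measure Ω)
    [IsProbabilityMeasure P] (hf : Measurable f) (hi : Integrable f) {τ : Ω → V}
    (hτ : Measurable τ) :
    Integrable (fun r : Ω × V => f (r.2 + τ r.1)) (P.prod volume) := by
  have hm : Measurable fun r : Ω × V => f (r.2 + τ r.1) := by fun_prop
  refine (integrable_prod_iff hm.aestronglyMeasurable).2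
    ⟨Eventually.of_forall fun ω => hi.comp_add_right (τ ω), ?_⟩
  have : ∀ ω, ∫ v, ‖f (v + τ ω)‖ = ∫ v, ‖f v‖ := fun ω =>
    integral_add_right_eq_self (fun v => ‖f v‖) (τ ω)
  simp_rw [this]
  exact integrable_const _

/-- A heat average of the correlation is an integral of box norms. -/
lemma form_heat_eq (hf : Measurable f) (hi : Integrable f) (h0 : ∀ v, 0 ≤ f v)
    (h1 : ∀ v, f v ≤ 1) (ι₁ ι₂ : ℂ →L[ℝ] V) (s t : ℝ) :
    let h := fun v z w => f (v + shift ι₁ ι₂ s t z w)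
    let γ := stdGaussian ℂ
    let G := fun v => ∫ q : ℂ × ℂ, ∫ p : ℂ × ℂ,
        (h v p.1 q.1 * h v p.1 q.2) * (h v p.2 q.1 * h v p.2 q.2) ∂(γ.prod γ) ∂(γ.prod γ)
    Integrable G ∧
    form (fun z w => corr f (ι₁ z) (ι₂ w)) (heat s) (heat t) = ∫ v, G v := by
  intro h γ G
  have hb := isBispectral_corr hf hi h0 h1 ι₁ ι₂
  set P := (γ.prod γ).prod (γ.prod γ) with hP
  have hsh := measurable_shift ι₁ ι₂ s t
  have hh : ∀ (a b : ℂ × ℂ → ℂ), Measurable a → Measurable b → Measurable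
      fun r : ((ℂ × ℂ) × (ℂ × ℂ)) × V => h r.2 (a r.1.2) (b r.1.1) := by
    intro a b ha hb
    refine hf.comp (measurable_snd.add (hsh.comp (f := fun r : ((ℂ × ℂ) × (ℂ × ℂ)) × V =>
      (a r.1.2, b r.1.1)) (by fun_prop)))
  set Φ : ((ℂ × ℂ) × (ℂ × ℂ)) × V → ℝ := fun r =>
    (h r.2 r.1.2.1 r.1.1.1 * h r.2 r.1.2.1 r.1.1.2) *
      (h r.2 r.1.2.2 r.1.1.1 * h r.2 r.1.2.2 r.1.1.2) with hΦ
  have hΦm : Measurable Φ :=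
    ((hh _ _ measurable_fst measurable_fst).mul (hh _ _ measurable_fst measurable_snd)).mul
      ((hh _ _ measurable_snd measurable_fst).mul (hh _ _ measurable_snd measurable_snd))
  have hΦi : Integrable Φ (P.prod volume) := by
    have := integrable_comp_add_prod P hf hi
      (τ := fun r => shift ι₁ ι₂ s t r.2.1 r.1.1)
      (hsh.comp (f := fun r : (ℂ × ℂ) × (ℂ × ℂ) => (r.2.1, r.1.1)) (by fun_prop))
    refine this.mono' hΦm.aestronglyMeasurable (Eventually.of_forall fun r => ?_)
    have n : ∀ z w, 0 ≤ h r.2 z w := fun z w => h0 _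
    have l : ∀ z w, h r.2 z w ≤ 1 := fun z w => h1 _
    rw [Real.norm_eq_abs, abs_of_nonneg
      (mul_nonneg (mul_nonneg (n _ _) (n _ _)) (mul_nonneg (n _ _) (n _ _)))]
    have a := n r.1.2.1 r.1.1.1
    have b := n r.1.2.1 r.1.1.2
    have c := n r.1.2.2 r.1.1.1
    have d := n r.1.2.2 r.1.1.2
    calc Φ r ≤ h r.2 r.1.2.1 r.1.1.1 * 1 * (1 * 1) := by
            simp only [hΦ]; gcongr <;> exact l _ _
      _ = _ := by ring
  have hΦb : ∀ r, |Φ r| ≤ 1 := by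
    intro r
    have n : ∀ z w, |h r.2 z w| ≤ 1 := fun z w =>
      abs_le.2 ⟨by linarith [h0 (r.2 + shift ι₁ ι₂ s t z w)], h1 _⟩
    simp only [hΦ, abs_mul]
    refine mul_le_one₀ (mul_le_one₀ (n _ _) (abs_nonneg _) (n _ _)) (by positivity)
      (mul_le_one₀ (n _ _) (abs_nonneg _) (n _ _))
  have hG : ∀ v, G v = ∫ r, Φ (r, v) ∂P := by
    intro v
    have : Integrable (fun r => Φ (r, v)) P := (integrable_const (1 : ℝ)).mono'
      (hΦm.comp measurable_prodMk_right).aestronglyMeasurable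
      (Eventually.of_forall fun r => hΦb _)
    rw [hP, integral_prod _ this]
  have hcorr : ∀ p q : ℂ × ℂ, corr f (ι₁ (s * (p.1 - p.2))) (ι₂ (t * (q.1 - q.2))) =
      ∫ v, Φ ((q, p), v) := by
    intro p q
    -- Translating `v` by one vertex places the four vertices at `v + shift (p i) (q j)`, the
    -- pattern of the box norm.
    rw [corr, ← integral_add_right_eq_self _ (shift ι₁ ι₂ s t p.2 q.2)]
    congr 1 with v
    have a1 : v + shift ι₁ ι₂ s t p.2 q.2 + ι₂ (t * (q.1 - q.2)) =
        v + shift ι₁ ι₂ s t p.2 q.1 := by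
      simp only [shift, mul_sub, map_sub]; abel
    have a2 : v + shift ι₁ ι₂ s t p.2 q.2 + ι₁ (s * (p.1 - p.2)) =
        v + shift ι₁ ι₂ s t p.1 q.2 := by
      simp only [shift, mul_sub, map_sub]; abel
    have a3 : v + shift ι₁ ι₂ s t p.1 q.2 + ι₂ (t * (q.1 - q.2)) =
        v + shift ι₁ ι₂ s t p.1 q.1 := by
      simp only [shift, mul_sub, map_sub]; abel
    simp only [a1, a2, a3, hΦ, h]
    ring
  have hcm : Measurable fun r : ℂ × ℂ => corr f (ι₁ r.1) (ι₂ r.2) := hb.measurable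
  refine ⟨?_, ?_⟩
  · rw [funext hG]
    exact hΦi.integral_prod_right
  · rw [funext hG, ← integral_integral_swap (f := fun r v => Φ (r, v)) hΦi, hP,
      integral_prod _ hΦi.integral_prod_left, form, heat, heat,
      integral_map (by fun_prop)]
    · congr 1 with q
      rw [integral_map (by fun_prop)]
      · simp_rw [hcorr]
        rfl
      · exact (hcm.comp measurable_prodMk_right).aestronglyMeasurable
    · have := (hcm.comp measurable_swap).stronglyMeasurable
      exact (this.integral_prod_right' (ν := Measure.map _ _)).aestronglyMeasurable

/-- Lower bound for heat averages of the correlation of a function most of whose translates live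
in a set `B` of finite measure. -/
lemma pow_four_le_form_heat (hf : Measurable f) (hi : Integrable f) (h0 : ∀ v, 0 ≤ f v)
    (h1 : ∀ v, f v ≤ 1) (ι₁ ι₂ : ℂ →L[ℝ] V) (s t : ℝ) {B : Set V}
    (hBfin : volume B ≠ ∞) {Γ : Set (ℂ × ℂ)} (hΓ : MeasurableSet Γ)
    (hΓ2 : 1 / 2 ≤ ((stdGaussian ℂ).prod (stdGaussian ℂ)).real Γ)
    (hΓB : ∀ p ∈ Γ, ∀ v, f (v + shift ι₁ ι₂ s t p.1 p.2) ≠ 0 → v ∈ B) :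
    ((∫ v, f v) / 2) ^ 4 ≤ (volume.real B) ^ 3 *
      form (fun z w => corr f (ι₁ z) (ι₂ w)) (heat s) (heat t) := by
  obtain ⟨hG, hform⟩ := form_heat_eq hf hi h0 h1 ι₁ ι₂ s t
  rw [hform]
  set γ := stdGaussian ℂ with hγ
  set h := fun v z w => f (v + shift ι₁ ι₂ s t z w) with hh
  have hsh := measurable_shift ι₁ ι₂ s t
  have hhm : ∀ v, Measurable (Function.uncurry (h v)) := fun v =>
    hf.comp (measurable_const.add hsh)
  have hhm2 : Measurable fun r : V × (ℂ × ℂ) => h r.1 r.2.1 r.2.2 :=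
    hf.comp (measurable_fst.add (hsh.comp measurable_snd))
  have habs : ∀ v z w, |h v z w| ≤ 1 := fun v z w =>
    abs_le.2 ⟨by linarith [h0 (v + shift ι₁ ι₂ s t z w)], h1 _⟩
  have hbox := fun v => box_inequality γ γ (hhm v) (fun _ _ => h0 _) (fun _ _ => h1 _)
  have hSeq : ∀ v, ∫ z, ∫ w, h v z w ∂γ ∂γ = ∫ p, h v p.1 p.2 ∂(γ.prod γ) := fun v =>
    (integral_prod _ ((integrable_const (1 : ℝ)).mono' (hhm v).aestronglyMeasurable
      (Eventually.of_forall fun r => habs _ _ _))).symm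
  simp_rw [hSeq] at hbox
  set S := fun v => ∫ p, h v p.1 p.2 ∂(γ.prod γ) with hS
  have hSm : Measurable S := hhm2.stronglyMeasurable.integral_prod_right.measurable
  have hSb : ∀ v, |S v| ≤ 1 := fun v => abs_integral_le_one _ fun p => habs v p.1 p.2
  have : IsFiniteMeasure (volume.restrict B) := ⟨by simpa using hBfin.lt_top⟩
  have hB1 : (volume.restrict B).real Set.univ = volume.real B := by
    simp [measureReal_def]
  -- Two applications of Cauchy–Schwarz on `B` bound `(∫ S)⁴` by `|B|³ ∫ S⁴`.
  have c1 := sq_integral_le (volume.restrict B) hSm hSb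
  have c2 := sq_integral_le (volume.restrict B) (hSm.pow_const 2) (B := 1) fun v => by
    rw [abs_pow]; exact pow_le_one₀ (abs_nonneg _) (hSb v)
  rw [hB1] at c1 c2
  have c3 : ∫ v in B, (S v ^ 2) ^ 2 ≤ ∫ v, ∫ q : ℂ × ℂ, ∫ p : ℂ × ℂ,
      (h v p.1 q.1 * h v p.1 q.2) * (h v p.2 q.1 * h v p.2 q.2) ∂(γ.prod γ) ∂(γ.prod γ) := by
    refine le_trans ?_ (setIntegral_le_integral (s := B) hG (Eventually.of_forall fun v => ?_))
    · refine integral_mono_of_nonneg (Eventually.of_forall fun v => by positivity)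
        hG.integrableOn (Eventually.of_forall fun v => ?_)
      refine le_trans (le_of_eq ?_) (hbox v)
      ring
    · refine le_trans ?_ (hbox v)
      positivity
  -- For `p ∈ Γ` the translate of `f` vanishes off `B` and keeps its full integral; the factor `1 /
  -- 2` is the lower bound for the probability of `Γ`.
  have c4 : (∫ v, f v) / 2 ≤ ∫ v in B, S v := by
    have i1 : Integrable (fun r : (ℂ × ℂ) × V => h r.2 r.1.1 r.1.2)
        ((γ.prod γ).prod (volume.restrict B)) := by
      have := integrable_comp_add_prod (γ.prod γ) hf hi hsh
      refine this.mono_measure ?_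
      exact Measure.prod_mono le_rfl Measure.restrict_le_self
    have i2 := integral_integral_swap (f := fun (p : ℂ × ℂ) v => h v p.1 p.2) i1
    simp only [hS]
    rw [← i2]
    have i3 : Integrable (fun p : ℂ × ℂ => ∫ v in B, h v p.1 p.2) (γ.prod γ) :=
      i1.integral_prod_left
    have i4 : ∀ p : ℂ × ℂ, 0 ≤ ∫ v in B, h v p.1 p.2 := fun p => integral_nonneg fun v => h0 _
    refine le_trans ?_ (setIntegral_le_integral (s := Γ) i3 (Eventually.of_forall i4))
    have i5 : ∫ p in Γ, (∫ v in B, h v p.1 p.2) ∂(γ.prod γ) =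
        ∫ _p in Γ, (∫ v, f v) ∂(γ.prod γ) := by
      refine setIntegral_congr_fun hΓ fun p hp => ?_
      rw [setIntegral_eq_integral_of_forall_compl_eq_zero fun v hv => ?_]
      · exact integral_add_right_eq_self f _
      · by_contra hne
        exact hv (hΓB p hp v hne)
    rw [i5, setIntegral_const, smul_eq_mul]
    have := integral_nonneg (μ := (volume : Measure V)) (f := f) h0
    nlinarith
  have c5 : 0 ≤ (∫ v, f v) / 2 := by
    have := integral_nonneg (μ := (volume : Measure V)) (f := f) h0
    positivity
  have hB0 : 0 ≤ volume.real B := measureReal_nonneg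
  calc ((∫ v, f v) / 2) ^ 4 = (((∫ v, f v) / 2) ^ 2) ^ 2 := by ring
    _ ≤ ((∫ v in B, S v) ^ 2) ^ 2 := by gcongr
    _ ≤ (volume.real B * ∫ v in B, S v ^ 2) ^ 2 := by gcongr
    _ = volume.real B ^ 2 * (∫ v in B, S v ^ 2) ^ 2 := by ring
    _ ≤ volume.real B ^ 2 * (volume.real B * ∫ v in B, (S v ^ 2) ^ 2) := by gcongr
    _ = volume.real B ^ 3 * ∫ v in B, (S v ^ 2) ^ 2 := by ring
    _ ≤ _ := by gcongr

end Correlation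

/-! ### From positive density to parallelograms at every large scale -/

section Density

open ProbabilityTheory Topology

lemma ae_norm_circ {s : ℝ} (hs : 0 ≤ s) : ∀ᵐ z ∂(circ s), ‖z‖ = s := by
  rw [circ, ae_map_iff (measurable_circlePoint s).aemeasurable
    (measurableSet_eq_fun measurable_norm measurable_const)]
  refine Eventually.of_forall fun θ => ?_
  rw [circlePoint, norm_mul, Complex.norm_exp_ofReal_mul_I, Complex.norm_real, mul_one,
    Real.norm_eq_abs, abs_of_nonneg hs]

lemma cube_eq_preimage {d : ℕ} (t : EuclideanSpace ℝ (Fin d)) (N : ℝ) :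
    cube t N = (WithLp.ofLp : EuclideanSpace ℝ (Fin d) → Fin d → ℝ) ⁻¹'
      Set.Icc (fun i => t i - N / 2) (fun i => t i + N / 2) := by
  ext x
  simp [cube, Pi.le_def, forall_and]

lemma measurableSet_cube {d : ℕ} (t : EuclideanSpace ℝ (Fin d)) (N : ℝ) :
    MeasurableSet (cube t N) := by
  rw [cube_eq_preimage]
  exact (PiLp.volume_preserving_ofLp (Fin d)).measurable measurableSet_Icc

lemma volume_cube {d : ℕ} (t : EuclideanSpace ℝ (Fin d)) (N : ℝ) :
    volume (cube t N) = ENNReal.ofReal N ^ d := by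
  rw [cube_eq_preimage, (PiLp.volume_preserving_ofLp (Fin d)).measure_preimage
    measurableSet_Icc.nullMeasurableSet, Real.volume_Icc_pi]
  have : ∀ i, t i + N / 2 - (t i - N / 2) = N := fun i => by ring
  simp [this]

/-- Continuity from below along growing balls. It is used to confine Gaussian shifts, which have
unbounded support, to a cube with probability at least one half. -/
lemma exists_half_le_measure {Ω V : Type*} [MeasurableSpace Ω] [NormedAddCommGroup V]
    (P : Measure Ω) [IsProbabilityMeasure P] (τ : Ω → V) :
    ∃ R₀ : ℝ, ∀ R, R₀ ≤ R → 1 / 2 ≤ P.real {ω | ‖τ ω‖ ≤ R} := by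
  have hmono : Monotone fun n : ℕ => {ω | ‖τ ω‖ ≤ n} := fun m n hmn ω (hω : ‖τ ω‖ ≤ m) =>
    hω.trans (by exact_mod_cast hmn)
  have h1 := tendsto_measure_iUnion_atTop (μ := P) hmono
  have h2 : ⋃ n : ℕ, {ω | ‖τ ω‖ ≤ n} = Set.univ :=
    Set.eq_univ_of_forall fun ω => Set.mem_iUnion.2 (exists_nat_ge ‖τ ω‖)
  rw [h2, measure_univ] at h1
  have h3 := (ENNReal.tendsto_toReal ENNReal.one_ne_top).comp h1
  obtain ⟨n, hn⟩ := (h3.eventually_const_lt (u := 1 / 2) (by norm_num)).exists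
  refine ⟨n, fun R hR => hn.le.trans ?_⟩
  refine measureReal_mono fun ω (hω : ‖τ ω‖ ≤ n) => hω.trans hR

/-- Positive upper Banach density gives large cubes in which the set is dense. -/
lemma exists_frequently_dense {d : ℕ} {A : Set (EuclideanSpace ℝ (Fin d))}
    (hpos : 0 < upperBanachDensity A) :
    ∃ η : ℝ, 0 < η ∧ ∃ᶠ N in atTop, ∃ t, η * N ^ d ≤ volume.real (A ∩ cube t N) := by
  obtain ⟨δ, hδ0, hδ⟩ := exists_between hpos
  have hδtop : δ ≠ ∞ := hδ.ne_top
  refine ⟨δ.toReal, ENNReal.toReal_pos hδ0.ne' hδtop, ?_⟩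
  have h1 := (frequently_lt_of_lt_limsup (by isBoundedDefault) hδ).and_eventually
    (eventually_gt_atTop 0)
  refine h1.mono fun N ⟨hN, hN0⟩ => ?_
  obtain ⟨t, ht⟩ := lt_iSup_iff.1 hN
  refine ⟨t, ?_⟩
  rw [volume_cube] at ht
  have h2 : δ * ENNReal.ofReal N ^ d ≤ volume (A ∩ cube t N) := by
    have hne : ENNReal.ofReal N ^ d ≠ 0 := pow_ne_zero _ (by simpa using hN0)
    exact ((ENNReal.lt_div_iff_mul_lt (.inl hne) (.inl (by simp))).1 ht).le
  have h3 : volume (A ∩ cube t N) ≠ ∞ :=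
    ((measure_mono Set.inter_subset_right).trans_lt (by simp [volume_cube])).ne
  have h4 := ENNReal.toReal_mono h3 h2
  rwa [ENNReal.toReal_mul, ENNReal.toReal_pow, ENNReal.toReal_ofReal hN0.le] at h4

/-- A property which holds for arbitrarily large numbers holds along a sequence growing at least
geometrically. -/
lemma exists_lacunary {p : ℝ → Prop} (h : ∀ x : ℝ, 0 < x → ∃ y, x ≤ y ∧ p y) :
    ∃ l : ℕ → ℝ, (∀ j, 0 < l j) ∧ (∀ j, 2 * l j ≤ l (j + 1)) ∧ ∀ j, p (l j) := by
  choose! g hg using h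
  let l : ℕ → ℝ := fun n => Nat.rec (g 1) (fun _ x => g (2 * x)) n
  have hl : ∀ j, l (j + 1) = g (2 * l j) := fun j => rfl
  have h0 : ∀ j, 0 < l j := by
    intro j
    induction j with
    | zero => exact one_pos.trans_le (hg 1 one_pos).1
    | succ n ih => rw [hl]; linarith [(hg (2 * l n) (by positivity)).1]
  refine ⟨l, h0, fun j => (hg _ (mul_pos two_pos (h0 j))).1, fun j => ?_⟩
  cases j with
  | zero => exact (hg 1 one_pos).2
  | succ n => exact (hg _ (mul_pos two_pos (h0 n))).2

/-- If every parallelogram with the given side lengths along two planes misses `D`, then the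
circular average of the correlation of the indicator of `D` vanishes. -/
lemma form_circ_eq_zero {V : Type*} [NormedAddCommGroup V] [InnerProductSpace ℝ V]
    [MeasurableSpace V] [BorelSpace V] [FiniteDimensional ℝ V] {D : Set V} (ι₁ ι₂ : ℂ →L[ℝ] V)
    {s t : ℝ} (hs : 0 ≤ s) (ht : 0 ≤ t)
    (hD : ∀ (v : V) (z w : ℂ), ‖z‖ = s → ‖w‖ = t →
      ¬ (v ∈ D ∧ v + ι₂ w ∈ D ∧ v + ι₁ z ∈ D ∧ v + ι₁ z + ι₂ w ∈ D)) :
    form (fun z w => corr (D.indicator 1) (ι₁ z) (ι₂ w)) (circ s) (circ t) = 0 := by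
  refine integral_eq_zero_of_ae ?_
  filter_upwards [ae_norm_circ ht] with w hw
  refine integral_eq_zero_of_ae ?_
  filter_upwards [ae_norm_circ hs] with z hz
  refine integral_eq_zero_of_ae (Eventually.of_forall fun v => ?_)
  by_contra hne
  simp only [Pi.zero_apply, mul_eq_zero, not_or, Set.indicator_apply_eq_zero, Pi.one_apply,
    one_ne_zero, imp_false, not_not] at hne
  exact hD v z w hz hw ⟨hne.1.1, hne.1.2, hne.2.1, hne.2.2⟩

/-- In a set of positive upper Banach density all large dilates of a parallelogram type spanned by
two planes occur. -/
theorem exists_parallelogram {d : ℕ} {A : Set (EuclideanSpace ℝ (Fin d))}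
    (hA : NullMeasurableSet A volume) (hpos : 0 < upperBanachDensity A)
    (ι₁ ι₂ : ℂ →L[ℝ] EuclideanSpace ℝ (Fin d)) {a b : ℝ} (ha : 0 ≤ a) (hb : 0 ≤ b) :
    ∃ l₀ : ℝ, 0 < l₀ ∧ ∀ l, l₀ ≤ l → ∃ (v : EuclideanSpace ℝ (Fin d)) (z w : ℂ),
      ‖z‖ = l * a ∧ ‖w‖ = l * b ∧
      v ∈ A ∧ v + ι₂ w ∈ A ∧ v + ι₁ z ∈ A ∧ v + ι₁ z + ι₂ w ∈ A := by
  by_contra hcon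
  push Not at hcon
  obtain ⟨l, hl0, hl2, hbad⟩ := exists_lacunary hcon
  -- A measurable subset of full measure keeps all densities, and configurations found in it lie in
  -- `A`.
  obtain ⟨A', hA'A, hA'm, hA'ae⟩ := hA.exists_measurable_subset_ae_eq
  obtain ⟨η, hη, hfreq⟩ := exists_frequently_dense hpos
  -- The `16` comes from `(M / 2) ^ 4`, the `8 ^ d` from the cubed volume of the doubled cube, and
  -- `η ^ 3` from `N ^ d ≤ M / η`.
  set θ : ℝ := η ^ 3 / (16 * 8 ^ d) with hθ
  have hθ0 : 0 < θ := by positivity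
  obtain ⟨K, hK, hform⟩ := exists_form_circ_ge (ε := θ / 4) (by positivity)
  obtain ⟨J, hJ⟩ := exists_nat_gt (4 * K / θ)
  have hJ0 : 0 < J := by
    have : (0 : ℝ) < J := lt_of_le_of_lt (by positivity) hJ
    exact_mod_cast this
  have hR := fun j => exists_half_le_measure ((stdGaussian ℂ).prod (stdGaussian ℂ))
    (Function.uncurry (shift ι₁ ι₂ (l j * a) (l j * b)))
  choose R hR using hR
  -- The number `J` of scales does not depend on `N`, so one cube can be taken large relative to all
  -- of them. Shifts of norm at most `N / 2` then move points of the cube only within the doubled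
  -- cube.
  have hev : ∀ᶠ N : ℝ in atTop, ∀ j ∈ Finset.range J, 2 * R j ≤ N :=
    (Finset.eventually_all _).2 fun j _ => eventually_ge_atTop _
  obtain ⟨N, ⟨t, ht⟩, hNR, hN0⟩ :=
    (hfreq.and_eventually (hev.and (eventually_gt_atTop 0))).exists
  set D := A' ∩ cube t N with hD
  have hDm : MeasurableSet D := hA'm.inter (measurableSet_cube t N)
  have hDfin : volume D ≠ ∞ :=
    ((measure_mono Set.inter_subset_right).trans_lt (by simp [volume_cube])).ne
  have hDvol : volume.real (A ∩ cube t N) = volume.real D :=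
    measureReal_congr (hA'ae.symm.inter (ae_eq_refl _))
  rw [hDvol] at ht
  set f : EuclideanSpace ℝ (Fin d) → ℝ := D.indicator 1 with hf
  have hfm : Measurable f := measurable_one.indicator hDm
  have hfi : Integrable f := (integrable_indicator_iff hDm).2 (integrableOn_const hDfin)
  have hf0 : ∀ v, 0 ≤ f v := fun v => Set.indicator_nonneg (fun _ _ => zero_le_one) v
  have hf1 : ∀ v, f v ≤ 1 := fun v => Set.indicator_le_self' (fun _ _ => zero_le_one) v
  set M := ∫ v, f v with hM
  have hMD : M = volume.real D := by rw [hM, hf, integral_indicator_one hDm]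
  rw [← hMD] at ht
  have hM0 : 0 < M := lt_of_lt_of_le (by positivity) ht
  have hbis := isBispectral_corr hfm hfi hf0 hf1 ι₁ ι₂
  set C := fun z w => corr f (ι₁ z) (ι₂ w) with hC
  set F : ℝ → ℝ := fun s => form C (heat (s * a)) (heat (s * b)) with hF
  obtain ⟨j, hjJ, hj⟩ := exists_small_drop (F := F) (M := M) (fun s => hbis.form_nonneg _ _)
    (fun s => hbis.form_le _ _) (fun s t hs hst => hbis.form_heat_anti ha hb hs hst)
    (fun j => (hl0 j).le) hl2 hJ0
  have hzero : form C (circ (l j * a)) (circ (l j * b)) = 0 := by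
    refine form_circ_eq_zero ι₁ ι₂ (mul_nonneg (hl0 j).le ha) (mul_nonneg (hl0 j).le hb)
      fun v z w hz hw ⟨h1, h2, h3, h4⟩ => ?_
    exact hbad j v z w hz hw (hA'A h1.1) (hA'A h2.1) (hA'A h3.1) (hA'A h4.1)
  have hlow : θ * M ≤ F (l j) := by
    have hB : volume.real (cube t (2 * N)) = (2 * N) ^ d := by
      rw [measureReal_def, volume_cube, ENNReal.toReal_pow, ENNReal.toReal_ofReal (by positivity)]
    have h4 := pow_four_le_form_heat hfm hfi hf0 hf1 ι₁ ι₂ (l j * a) (l j * b)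
      (B := cube t (2 * N))
      (by rw [volume_cube]; exact ENNReal.pow_ne_top ENNReal.ofReal_ne_top)
      (Γ := {p | ‖Function.uncurry (shift ι₁ ι₂ (l j * a) (l j * b)) p‖ ≤ N / 2})
      (measurableSet_le (measurable_shift _ _ _ _).norm measurable_const)
      (hR j _ (by linarith [hNR j (Finset.mem_range.2 hjJ)])) fun p hp v hv i => by
        have hmem : v + shift ι₁ ι₂ (l j * a) (l j * b) p.1 p.2 ∈ D := by
          by_contra hn
          exact hv (Set.indicator_of_notMem hn _)
        have h5 := hmem.2 i
        have h6 : |shift ι₁ ι₂ (l j * a) (l j * b) p.1 p.2 i| ≤ N / 2 :=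
          (PiLp.norm_apply_le _ i).trans hp
        rw [PiLp.add_apply] at h5
        have h7 := abs_le.1 h6
        exact ⟨by linarith [h5.1], by linarith [h5.2]⟩
    rw [hB] at h4
    change (M / 2) ^ 4 ≤ ((2 * N) ^ d) ^ 3 * F (l j) at h4
    have hF0 : 0 ≤ F (l j) := hbis.form_nonneg _ _
    have h5 : ((2 * N) ^ d) ^ 3 ≤ 8 ^ d * (M / η) ^ 3 := by
      have : N ^ d ≤ M / η := by rw [le_div_iff₀ hη]; linarith
      calc ((2 * N) ^ d) ^ 3 = 8 ^ d * (N ^ d) ^ 3 := by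
            rw [mul_pow, mul_pow, ← pow_mul, mul_comm d 3, pow_mul]; norm_num
        _ ≤ _ := by gcongr
    have h6 : (M / 2) ^ 4 ≤ 8 ^ d * (M / η) ^ 3 * F (l j) :=
      h4.trans (mul_le_mul_of_nonneg_right h5 hF0)
    have h7 : θ * M * (8 ^ d * (M / η) ^ 3) = (M / 2) ^ 4 := by
      rw [hθ]; field_simp; norm_num
    have h8 : 0 < 8 ^ d * (M / η) ^ 3 := by positivity
    rw [← h7, mul_comm (8 ^ d * (M / η) ^ 3)] at h6
    exact le_of_mul_le_mul_right h6 h8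
  have hmain := hform C M hbis a b (l j) ha hb (hl0 j).le
  rw [hzero] at hmain
  change F (l j) - θ / 4 * M - K * (F (l j / 2) - F (l j)) ≤ 0 at hmain
  have hJ' : 4 * K < θ * J := by rw [div_lt_iff₀ hθ0] at hJ; linarith
  have hJpos : (0 : ℝ) < J := by exact_mod_cast hJ0
  have hdrop : K * (F (l j / 2) - F (l j)) ≤ θ / 4 * M := by
    have e1 : K * (F (l j / 2) - F (l j)) * J ≤ K * M := by nlinarith
    have e2 : K * M ≤ θ / 4 * M * J := by nlinarith
    exact le_of_mul_le_mul_right (e1.trans e2) hJpos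
  -- The circular average would be at least `θ M - θ M / 4 - θ M / 4 > 0`, although it vanishes.
  nlinarith

end Density

/-! ### Rotations, coordinate splittings and rectangles -/

section Geometry

lemma det_linearIsometryEquiv {E : Type*} [NormedAddCommGroup E] [InnerProductSpace ℝ E]
    [FiniteDimensional ℝ E] (U : E ≃ₗᵢ[ℝ] E) :
    LinearMap.det (U.toLinearEquiv : E →ₗ[ℝ] E) = 1 ∨
      LinearMap.det (U.toLinearEquiv : E →ₗ[ℝ] E) = -1 := by
  have h := U.toLinearIsometry.normDet_eq_one
  rw [LinearMap.normDet_eq_abs_det] at h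
  exact (abs_eq zero_le_one).1 h

lemma exists_orthonormalBasis_pair {d : ℕ} (hd : 2 ≤ d) {p q : EuclideanSpace ℝ (Fin d)}
    (hp : p ≠ 0) (hq : q ≠ 0) (hpq : inner ℝ p q = 0) :
    ∃ b : OrthonormalBasis (Fin d) ℝ (EuclideanSpace ℝ (Fin d)),
      p = ‖p‖ • b ⟨0, by omega⟩ ∧ q = ‖q‖ • b ⟨1, by omega⟩ := by
  set i₀ : Fin d := ⟨0, by omega⟩ with hi₀
  set i₁ : Fin d := ⟨1, by omega⟩ with hi₁
  have hne : i₁ ≠ i₀ := by simp [hi₀, hi₁]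
  set v : Fin d → EuclideanSpace ℝ (Fin d) :=
    fun i => if i = i₀ then ‖p‖⁻¹ • p else ‖q‖⁻¹ • q with hv
  have hv0 : v i₀ = ‖p‖⁻¹ • p := by simp [hv]
  have hv1 : v i₁ = ‖q‖⁻¹ • q := by simp [hv, hne]
  have hp' : ‖p‖ ≠ 0 := norm_ne_zero_iff.2 hp
  have hq' : ‖q‖ ≠ 0 := norm_ne_zero_iff.2 hq
  have hon : Orthonormal ℝ (({i₀, i₁} : Set (Fin d)).domRestrict v) := by
    refine ⟨fun i => ?_, fun i j hij => ?_⟩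
    · obtain ⟨i, rfl | rfl⟩ := i
      · simp [Set.domRestrict, hv0, norm_smul, hp']
      · simp [Set.domRestrict, hv1, norm_smul, hq']
    · obtain ⟨i, rfl | rfl⟩ := i <;> obtain ⟨j, rfl | rfl⟩ := j
      · exact absurd rfl hij
      · simp [Set.domRestrict, hv0, hv1, inner_smul_left, inner_smul_right, hpq]
      · simp [Set.domRestrict, hv0, hv1, inner_smul_left, inner_smul_right,
          real_inner_comm, hpq]
      · exact absurd rfl hij
  obtain ⟨b, hb⟩ := hon.exists_orthonormalBasis_extension_of_card_eq (by simp)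
  refine ⟨b, ?_, ?_⟩
  · rw [hb i₀ (by simp), hv0, smul_inv_smul₀ hp']
  · rw [hb i₁ (by simp), hv1, smul_inv_smul₀ hq']

/-- Rotations act transitively on orthogonal pairs of vectors of given nonzero lengths in
dimension at least three. -/
lemma exists_rotation {d : ℕ} (hd : 3 ≤ d) {p q u w : EuclideanSpace ℝ (Fin d)}
    (hp : p ≠ 0) (hq : q ≠ 0) (hpq : inner ℝ p q = 0) (huw : inner ℝ u w = 0)
    (hu : ‖u‖ = ‖p‖) (hw : ‖w‖ = ‖q‖) :
    ∃ U : EuclideanSpace ℝ (Fin d) ≃ₗᵢ[ℝ] EuclideanSpace ℝ (Fin d),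
      LinearMap.det (U.toLinearEquiv :
        EuclideanSpace ℝ (Fin d) →ₗ[ℝ] EuclideanSpace ℝ (Fin d)) = 1 ∧ U p = u ∧ U q = w := by
  obtain ⟨b, hb0, hb1⟩ := exists_orthonormalBasis_pair (by omega) hp hq hpq
  obtain ⟨b', hb0', hb1'⟩ := exists_orthonormalBasis_pair (p := u) (q := w) (by omega)
    (by rw [← norm_ne_zero_iff, hu]; exact norm_ne_zero_iff.2 hp)
    (by rw [← norm_ne_zero_iff, hw]; exact norm_ne_zero_iff.2 hq) huw
  set U₀ := b.equiv b' (Equiv.refl _) with hU₀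
  have h0 : U₀ p = u := by
    rw [hb0, hb0', hu, map_smul, OrthonormalBasis.equiv_apply_basis, Equiv.refl_apply]
  have h1 : U₀ q = w := by
    rw [hb1, hb1', hw, map_smul, OrthonormalBasis.equiv_apply_basis, Equiv.refl_apply]
  rcases det_linearIsometryEquiv U₀ with hdet | hdet
  · exact ⟨U₀, hdet, h0, h1⟩
  -- A wrong determinant is corrected by reflecting in the hyperplane orthogonal to a third basis
  -- vector, which fixes `u` and `w`; this needs `3 ≤ d`.
  · set x := b' ⟨2, by omega⟩ with hx
    have hx0 : x ≠ 0 := b'.orthonormal.ne_zero _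
    set L : Submodule ℝ (EuclideanSpace ℝ (Fin d)) := (Submodule.span ℝ {x})ᗮ with hL
    have hfix : ∀ (i : Fin d) (r : ℝ), i ≠ ⟨2, by omega⟩ → L.reflection (r • b' i) = r • b' i := by
      intro i r hi
      refine Submodule.reflection_mem_subspace_eq_self ?_
      refine Submodule.smul_mem _ _ ?_
      rw [hL, Submodule.mem_orthogonal_singleton_iff_inner_right]
      exact b'.orthonormal.2 hi.symm
    refine ⟨U₀.trans L.reflection, ?_, ?_, ?_⟩
    · have h2 : ((U₀.trans L.reflection).toLinearEquiv :
          EuclideanSpace ℝ (Fin d) →ₗ[ℝ] EuclideanSpace ℝ (Fin d)) =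
          (L.reflection.toLinearEquiv : EuclideanSpace ℝ (Fin d) →ₗ[ℝ] EuclideanSpace ℝ (Fin d)) ∘ₗ
            (U₀.toLinearEquiv : EuclideanSpace ℝ (Fin d) →ₗ[ℝ] EuclideanSpace ℝ (Fin d)) := rfl
      have h3 : LinearMap.det (L.reflection.toLinearEquiv : EuclideanSpace ℝ (Fin d) →ₗ[ℝ] _) =
          (-1) ^ Module.finrank ℝ Lᗮ := L.det_reflection
      rw [h2, LinearMap.det_comp, hdet, h3, hL, Submodule.orthogonal_orthogonal,
        finrank_span_singleton hx0]
      norm_num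
    · rw [LinearIsometryEquiv.trans_apply, h0, hb0']
      exact hfix _ _ (by simp)
    · rw [LinearIsometryEquiv.trans_apply, h1, hb1']
      exact hfix _ _ (by simp)

lemma incl_add (k d : ℕ) (p q : EuclideanSpace ℝ (Fin k)) :
    incl k d (p + q) = incl k d p + incl k d q := by
  ext i
  by_cases h : (i : ℕ) < k <;> simp [incl, h]

lemma incl_smul (k d : ℕ) (c : ℝ) (p : EuclideanSpace ℝ (Fin k)) :
    incl k d (c • p) = c • incl k d p := by
  ext i
  by_cases h : (i : ℕ) < k <;> simp [incl, h]

lemma inner_incl {k d : ℕ} (h : k ≤ d) (p q : EuclideanSpace ℝ (Fin k)) :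
    inner ℝ (incl k d p) (incl k d q) = inner ℝ p q := by
  obtain ⟨e, rfl⟩ := Nat.exists_eq_add_of_le h
  simp [PiLp.inner_apply, incl, Fin.sum_univ_add]

lemma norm_incl {k d : ℕ} (h : k ≤ d) (p : EuclideanSpace ℝ (Fin k)) :
    ‖incl k d p‖ = ‖p‖ := by
  rw [norm_eq_sqrt_real_inner, norm_eq_sqrt_real_inner, inner_incl h]

/-- Four points spanned by orthogonal vectors of the right lengths form an isometric copy of a
dilated rectangle. -/
lemma isIsometricCopy_rectangle {d : ℕ} (hd : 3 ≤ d) {v₁ v₂ : EuclideanSpace ℝ (Fin 2)}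
    (hv₁ : v₁ ≠ 0) (hv₂ : v₂ ≠ 0) (hv : inner ℝ v₁ v₂ = 0) {lam : ℝ} (hlam : 0 < lam)
    {x u w : EuclideanSpace ℝ (Fin d)} (hu : ‖u‖ = lam * ‖v₁‖) (hw : ‖w‖ = lam * ‖v₂‖)
    (huw : inner ℝ u w = 0) :
    IsIsometricCopy lam (rectangle v₁ v₂) {x, x + u, x + w, x + u + w} := by
  have h2 : 2 ≤ d := by omega
  obtain ⟨U, hU, hU1, hU2⟩ := exists_rotation hd (p := incl 2 d v₁) (q := incl 2 d v₂)
    (u := lam⁻¹ • u) (w := lam⁻¹ • w)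
    (by rw [← norm_ne_zero_iff, norm_incl h2]; exact norm_ne_zero_iff.2 hv₁)
    (by rw [← norm_ne_zero_iff, norm_incl h2]; exact norm_ne_zero_iff.2 hv₂)
    (by rw [inner_incl h2, hv])
    (by rw [real_inner_smul_left, real_inner_smul_right, huw]; simp)
    (by rw [norm_smul, norm_inv, Real.norm_of_nonneg hlam.le, hu, norm_incl h2,
      inv_mul_cancel_left₀ hlam.ne'])
    (by rw [norm_smul, norm_inv, Real.norm_of_nonneg hlam.le, hw, norm_incl h2,
      inv_mul_cancel_left₀ hlam.ne'])
  refine ⟨x, U, hU, ?_⟩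
  have h0 : incl 2 d (0 : EuclideanSpace ℝ (Fin 2)) = 0 := by
    simpa using incl_smul 2 d 0 0
  simp only [rectangle, Set.image_insert_eq, Set.image_singleton, incl_add, map_add, hU1, hU2,
    h0, map_zero, smul_zero, add_zero, smul_add, smul_inv_smul₀ hlam.ne', add_assoc]

section Pair

variable {d₁ d₂ d : ℕ} (h : d₁ + d₂ = d)

lemma pair_add (x x' : EuclideanSpace ℝ (Fin d₁)) (y y' : EuclideanSpace ℝ (Fin d₂)) :
    pair h (x + x') (y + y') = pair h x y + pair h x' y' := by
  subst h
  ext i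
  refine Fin.addCases (fun i => ?_) (fun i => ?_) i <;> simp [pair]

lemma pair_smul (c : ℝ) (x : EuclideanSpace ℝ (Fin d₁)) (y : EuclideanSpace ℝ (Fin d₂)) :
    pair h (c • x) (c • y) = c • pair h x y := by
  subst h
  ext i
  refine Fin.addCases (fun i => ?_) (fun i => ?_) i <;> simp [pair]

lemma inner_pair (x x' : EuclideanSpace ℝ (Fin d₁)) (y y' : EuclideanSpace ℝ (Fin d₂)) :
    inner ℝ (pair h x y) (pair h x' y') = inner ℝ x x' + inner ℝ y y' := by
  subst h
  simp [PiLp.inner_apply, pair, Fin.sum_univ_add]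

lemma exists_eq_pair (v : EuclideanSpace ℝ (Fin d)) : ∃ x y, v = pair h x y := by
  subst h
  refine ⟨WithLp.toLp 2 fun i => v (Fin.castAdd d₂ i), WithLp.toLp 2 fun i => v (Fin.natAdd d₁ i),
    ?_⟩
  ext i
  refine Fin.addCases (fun i => ?_) (fun i => ?_) i <;> simp [pair]

/-- The inclusion of the first factor. -/
def pairLeft : EuclideanSpace ℝ (Fin d₁) →ₗ[ℝ] EuclideanSpace ℝ (Fin d) where
  toFun x := pair h x 0
  map_add' x x' := by rw [← pair_add, add_zero]
  map_smul' c x := by rw [RingHom.id_apply, ← pair_smul, smul_zero]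

/-- The inclusion of the second factor. -/
def pairRight : EuclideanSpace ℝ (Fin d₂) →ₗ[ℝ] EuclideanSpace ℝ (Fin d) where
  toFun y := pair h 0 y
  map_add' y y' := by rw [← pair_add, add_zero]
  map_smul' c y := by rw [RingHom.id_apply, ← pair_smul, smul_zero]

end Pair

/-- The complex plane as the plane of the first two coordinates. -/
def planeMap (k : ℕ) : ℂ →ₗ[ℝ] EuclideanSpace ℝ (Fin k) where
  toFun z := incl 2 k (Complex.orthonormalBasisOneI.repr z)
  map_add' z w := by rw [map_add, incl_add]
  map_smul' c z := by rw [map_smul, incl_smul, RingHom.id_apply]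

lemma norm_planeMap {k : ℕ} (hk : 2 ≤ k) (z : ℂ) : ‖planeMap k z‖ = ‖z‖ := by
  change ‖incl 2 k (Complex.orthonormalBasisOneI.repr z)‖ = ‖z‖
  rw [norm_incl hk, LinearIsometryEquiv.norm_map]

/-- All large dilates of a rectangle occur along a given splitting of the coordinates. -/
theorem exists_rectangle_of_splitting {d : ℕ} {v₁ v₂ : EuclideanSpace ℝ (Fin 2)} (hv₁ : v₁ ≠ 0)
    (hv₂ : v₂ ≠ 0) (hv : inner ℝ v₁ v₂ = 0) {A : Set (EuclideanSpace ℝ (Fin d))}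
    (hA : NullMeasurableSet A volume) (hpos : 0 < upperBanachDensity A)
    {d₁ d₂ : ℕ} (h : d₁ + d₂ = d) (hd₁ : 2 ≤ d₁) (hd₂ : 2 ≤ d₂) :
    ∃ lam₀ : ℝ, 0 < lam₀ ∧ ∀ lam : ℝ, lam₀ ≤ lam →
      ∃ (x x' : EuclideanSpace ℝ (Fin d₁)) (y y' : EuclideanSpace ℝ (Fin d₂)),
        ‖x - x'‖ = lam * ‖v₁‖ ∧ ‖y - y'‖ = lam * ‖v₂‖ ∧
        ({pair h x y, pair h x' y, pair h x y', pair h x' y'} :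
          Set (EuclideanSpace ℝ (Fin d))) ⊆ A ∧
        IsIsometricCopy lam (rectangle v₁ v₂)
          {pair h x y, pair h x' y, pair h x y', pair h x' y'} := by
  obtain ⟨l₀, hl₀, H⟩ := exists_parallelogram hA hpos
    (pairLeft h ∘ₗ planeMap d₁).toContinuousLinearMap
    (pairRight h ∘ₗ planeMap d₂).toContinuousLinearMap (norm_nonneg v₁) (norm_nonneg v₂)
  refine ⟨l₀, hl₀, fun lam hlam => ?_⟩
  obtain ⟨v, z, w, hz, hw, m1, m2, m3, m4⟩ := H lam hlam
  obtain ⟨x, y, rfl⟩ := exists_eq_pair h v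
  change pair h x y + pair h 0 (planeMap d₂ w) ∈ A at m2
  change pair h x y + pair h (planeMap d₁ z) 0 ∈ A at m3
  change pair h x y + pair h (planeMap d₁ z) 0 + pair h 0 (planeMap d₂ w) ∈ A at m4
  set p := planeMap d₁ z with hp
  set q := planeMap d₂ w with hq
  have hpn : ‖p‖ = lam * ‖v₁‖ := by rw [hp, norm_planeMap hd₁, hz]
  have hqn : ‖q‖ = lam * ‖v₂‖ := by rw [hq, norm_planeMap hd₂, hw]
  have e1 : pair h (x + p) y = pair h x y + pair h p 0 := by rw [← pair_add, add_zero]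
  have e2 : pair h x (y + q) = pair h x y + pair h 0 q := by rw [← pair_add, add_zero]
  have e3 : pair h (x + p) (y + q) = pair h x y + pair h p 0 + pair h 0 q := by
    rw [← pair_add, ← pair_add, add_zero, add_zero]
  refine ⟨x, x + p, y, y + q, by rw [sub_add_cancel_left, norm_neg, hpn],
    by rw [sub_add_cancel_left, norm_neg, hqn], ?_, ?_⟩
  · rw [e1, e2, e3]
    rintro _ (rfl | rfl | rfl | rfl)
    exacts [m1, m3, m2, m4]
  · rw [e1, e2, e3]
    refine isIsometricCopy_rectangle (by omega) hv₁ hv₂ hv (hl₀.trans_le hlam) ?_ ?_ ?_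
    · rw [norm_eq_sqrt_real_inner, inner_pair, inner_zero_left, add_zero,
        ← norm_eq_sqrt_real_inner, hpn]
    · rw [norm_eq_sqrt_real_inner, inner_pair, inner_zero_left, zero_add,
        ← norm_eq_sqrt_real_inner, hqn]
    · rw [inner_pair, inner_zero_left, inner_zero_right, add_zero]

end Geometry

end RectBanach

end

theorem mainTheorem1 (d : ℕ) (hd : 4 ≤ d)
    (v₁ v₂ : EuclideanSpace ℝ (Fin 2)) (hv₁ : v₁ ≠ 0) (hv₂ : v₂ ≠ 0)
    (hv : inner ℝ v₁ v₂ = 0)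
    (A : Set (EuclideanSpace ℝ (Fin d))) (hA : NullMeasurableSet A volume)
    (hpos : 0 < RectBanach.upperBanachDensity A) :
    ∃ lam₀ : ℝ, 0 < lam₀ ∧ ∀ lam : ℝ, lam₀ ≤ lam →
      (∃ S : Set (EuclideanSpace ℝ (Fin d)), S ⊆ A ∧
        RectBanach.IsIsometricCopy lam (RectBanach.rectangle v₁ v₂) S) ∧
      ∀ (d₁ d₂ : ℕ) (h : d₁ + d₂ = d), 2 ≤ d₁ → 2 ≤ d₂ →
        ∃ (x x' : EuclideanSpace ℝ (Fin d₁)) (y y' : EuclideanSpace ℝ (Fin d₂)),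
          ‖x - x'‖ = lam * ‖v₁‖ ∧ ‖y - y'‖ = lam * ‖v₂‖ ∧
          ({RectBanach.pair h x y, RectBanach.pair h x' y, RectBanach.pair h x y',
            RectBanach.pair h x' y'} : Set (EuclideanSpace ℝ (Fin d))) ⊆ A ∧
          RectBanach.IsIsometricCopy lam (RectBanach.rectangle v₁ v₂)
            {RectBanach.pair h x y, RectBanach.pair h x' y, RectBanach.pair h x y',
              RectBanach.pair h x' y'} := by
  have key := fun (d₁ d₂ : ℕ) (h : d₁ + d₂ = d) (hd₁ : 2 ≤ d₁) (hd₂ : 2 ≤ d₂) =>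
    RectBanach.exists_rectangle_of_splitting hv₁ hv₂ hv hA hpos h hd₁ hd₂
  choose! L hL0 hL using key
  have hbound : ∀ d₁ d₂, d₁ + d₂ = d → L d₁ d₂ ≤
      1 + ∑ p ∈ Finset.HasAntidiagonal.antidiagonal d, |L p.1 p.2| := by
    intro d₁ d₂ h
    have := Finset.single_le_sum (f := fun p : ℕ × ℕ => |L p.1 p.2|)
      (fun p _ => abs_nonneg _) (Finset.HasAntidiagonal.mem_antidiagonal.2 (show (d₁, d₂).1 + (d₁, d₂).2 = d from h))
    linarith [le_abs_self (L d₁ d₂)]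
  -- There are finitely many splittings, so the sum dominates every threshold. Pairs with a factor
  -- of dimension below two carry arbitrary values of `L`, which only enlarge the bound.
  refine ⟨1 + ∑ p ∈ Finset.HasAntidiagonal.antidiagonal d, |L p.1 p.2|, by positivity, fun lam hlam => ?_⟩
  have hall := fun (d₁ d₂ : ℕ) (h : d₁ + d₂ = d) (hd₁ : 2 ≤ d₁) (hd₂ : 2 ≤ d₂) =>
    hL d₁ d₂ h hd₁ hd₂ lam ((hbound d₁ d₂ h).trans hlam)
  -- The unrestricted copy comes from the splitting `2 + (d - 2)`, admissible because `4 ≤ d`.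
  obtain ⟨x, x', y, y', -, -, hsub, hcopy⟩ := hall 2 (d - 2) (by omega) le_rfl (by omega)
  exact ⟨⟨_, hsub, hcopy⟩, hall⟩
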